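/- \textbf{Conventions.} An involution monoid $(M,{}^*)$ is a monoid with a unary operation satisfying $(x^*)^*=x$ and $(xy)^*=y^*x^*$. Let $\mathcal X$ be a countably infinite set and $\mathcal X^*=\{x^*: x\in\mathcal X\}$ a disjoint copy, with $(x^*)^*=x$; the elements of $\mathcal X\cup\mathcal X^*$ are called variables. Terms are built from $\mathcal X$ with (associative) concatenation and ${}^*$. An identity $s\approx t$ between terms holds in $(M,{}^*)$ if both sides take the same value under every map $\mathcal X\to M$. An identity is deducible from a set $\Sigma$ of identities if one can pass from one side to the other in finitely many steps, each replacing a subterm that is a substitution instance of one side of an identity of $\Sigma$ by the same instance of its other side. An identity basis of $(M,{}^*)$ is a set of identities of $(M,{}^*)$ from which every identity of $(M,{}^*)$ is deducible; $(M,{}^*)$ is non-finitely based if it has no finite identity basis. A word identity $\mathbf u\approx\mathbf v$ is an identity between nonempty words $\mathbf u,\mathbf v$ over $\mathcal X\cup\mathcal X^*$; it is non-trivial if $\mathbf u\ne\mathbf v$, and balanced if every variable of $\mathcal X\cup\mathcal X^*$ occurs equally often in $\mathbf u$ and $\mathbf v$. For a word $\mathbf u$, $\mathsf{con}(\mathbf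 u)$ is the set of variables occurring in $\mathbf u$; $\mathsf{ip}(\mathbf u)$ [resp. $\mathsf{fp}(\mathbf u)$] is obtained from $\mathbf u$ by keeping those occurrences of each variable $x$ to the left [resp. right] of which neither $x$ nor $x^*$ occurs; and $\mathbf u[x,y]$ is obtained from $\mathbf u$ by keeping only the occurrences of $x,x^*,y,y^*$. \textbf{The Baxter monoid.} For a word $w$ over the ordered alphabet $\mathcal A_n=\{1<\dots<n\}$, let $P(w)$ be the following pair of labelled binary trees. The first is obtained by reading $w$ from left to right and inserting each letter $a$ as a leaf into an initially empty binary tree, going left at a node labelled $x$ if $a<x$ and right otherwise. The second is obtained by reading $w$ from right to left and inserting each letter $a$ as a leaf, going right at a node labelled $x$ if $a>x$ and left otherwise. The relation $P(u)=P(v)$ is a congruence on the free monoid over $\mathcal A_n$, and the quotient is the Baxter monoid $\mathsf{baxt}_n$ of rank $n$. Sch\"utzenberger's involution ${}^\sharp$ on $\mathsf{baxt}_n$ is induced by $(w_1\cdots w_m)^\sharp=w_m^\sharp\cdots w_1^\sharp$ with $i^\sharp=n+1-i$ for $i\in\mathcal A_n$. \textbf{Theorem.} (A) Let $(M,{}^*)$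 be an involution monoid satisfying the following conditions. (I) For each $k\ge2$, $(M,{}^*)$ satisfies $\mathbf p_k\approx\mathbf q_k$, where, for distinct $x,x_1,\dots,x_{2k}\in\mathcal X$, $$\mathbf p_k=x_1^*x_2^*\cdots x_{2k}^*\cdot xx^*\cdot x^*\,x_1x_2\cdots x_{2k}\,x\cdot x^*x\cdot x_1^*x_3^*\cdots x_{2k-1}^*\,x_2^*x_4^*\cdots x_{2k}^*,$$ $$\mathbf q_k=x_1^*x_2^*\cdots x_{2k}^*\cdot xx^*\cdot x\,x_1x_2\cdots x_{2k}\,x^*\cdot x^*x\cdot x_1^*x_3^*\cdots x_{2k-1}^*\,x_2^*x_4^*\cdots x_{2k}^*.$$ (II) Every word identity $\mathbf u\approx\mathbf v$ of $(M,{}^*)$ is balanced and satisfies $\mathsf{ip}(\mathbf u)=\mathsf{ip}(\mathbf v)$ and $\mathsf{fp}(\mathbf u)=\mathsf{fp}(\mathbf v)$. (III) For distinct $x,y\in\mathcal X$, if $(M,{}^*)$ satisfies a non-trivial word identity $y^*xx^*\cdot x^*yx\cdot x^*xy^*\approx\mathbf w$, then $\mathbf w=y^*xx^*\cdot xyx^*\cdot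 x^*xy^*$. (IV) For every word identity $\mathbf u\approx\mathbf v$ of $(M,{}^*)$ and all $x,y\in\mathcal X\cup\mathcal X^*$ with $y\notin\{x,x^*\}$: (a) if $\mathbf u[x,y]=\mathbf a\,y\,\mathbf r$ for some words $\mathbf a,\mathbf r$ with $\mathsf{con}(\mathbf a)=\{x,x^*\}$, then $\mathbf v[x,y]=\mathbf a'\,y\,\mathbf r'$ for some word $\mathbf r'$ and some permutation $\mathbf a'$ of $\mathbf a$; (b) if $\mathbf u[x,y]=\mathbf r\,y\,\mathbf a$ for some words $\mathbf a,\mathbf r$ with $\mathsf{con}(\mathbf a)=\{x,x^*\}$, then $\mathbf v[x,y]=\mathbf r'\,y\,\mathbf a'$ for some word $\mathbf r'$ and some permutation $\mathbf a'$ of $\mathbf a$. Then $(M,{}^*)$ is non-finitely based. (B) The involution monoid $(\mathsf{baxt}_3,{}^\sharp)$ is non-finitely based. -/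

import Mathlib

namespace BaxterInv

/-! ### Words over `X ∪ X*`, where `X = {x₀, x₁, x₂, …}` is indexed by `ℕ` -/

/-- A variable of `X ∪ X*`: `(n, false)` is `xₙ` and `(n, true)` is `xₙ*`. -/
abbrev Letter := ℕ × Bool

/-- The variable `xₙ`. -/
abbrev pl (n : ℕ) : Letter := (n, false)

/-- The variable `xₙ*`. -/
abbrev st (n : ℕ) : Letter := (n, true)

/-- `x ↦ x*` and `x* ↦ x`. -/
def Letter.inv (a : Letter) : Letter := (a.1, !a.2)

/-- Words over `X ∪ X*`, including the empty word. -/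
abbrev Word := List Letter

/-- The initial part `ip u`: in `u`, keep an occurrence of `a` exactly when neither `a` nor `a*`
occurs to its left. -/
def initialPart : Word → Word
  | [] => []
  | a :: u => a :: (initialPart u).filter (fun b => b.1 ≠ a.1)

/-- The final part `fp u`: in `u`, keep an occurrence of `a` exactly when neither `a` nor `a*`
occurs to its right. -/
def finalPart (u : Word) : Word := (initialPart u.reverse).reverse

/-- `u[a, b]`: keep only the occurrences of `a, a*, b, b*` in `u`. -/
def restrict (u : Word) (a b : Letter) : Word :=
  u.filter (fun c => c.1 = a.1 ∨ c.1 = b.1)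

/-- The word identity `u ≈ v` is balanced: `occ(a, u) = occ(a, v)` for every variable `a`. -/
def BalancedIdentity (u v : Word) : Prop := ∀ a : Letter, u.count a = v.count a

/-- The value in an involution monoid of a word under a substitution `X → M`. -/
def Word.eval {M : Type*} [Monoid M] [StarMul M] (φ : ℕ → M) (u : Word) : M :=
  (u.map (fun a => if a.2 then star (φ a.1) else φ a.1)).prod

/-- The involution monoid `M` satisfies the word identity `u ≈ v`; both sides of an identity
are nonempty words. -/
def SatisfiesWord (M : Type*) [Monoid M] [StarMul M] (u v : Word) : Prop :=
  u ≠ [] ∧ v ≠ [] ∧ ∀ φ : ℕ → M, Word.eval φ u = Word.eval φ v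

/-- `x₁* x₂* ⋯ x₂ₖ*`. -/
def starAsc (k : ℕ) : Word := (List.range (2 * k)).map (fun i => st (i + 1))

/-- `x₁ x₂ ⋯ x₂ₖ`. -/
def plainAsc (k : ℕ) : Word := (List.range (2 * k)).map (fun i => pl (i + 1))

/-- `x₁* x₃* ⋯ x₂ₖ₋₁* x₂* x₄* ⋯ x₂ₖ*`. -/
def starOddEven (k : ℕ) : Word :=
  (List.range k).map (fun i => st (2 * i + 1)) ++ (List.range k).map (fun i => st (2 * i + 2))

/-- The word `p_k`, with `x₀` in the role of `x`. -/
def pWord (k : ℕ) : Word :=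
  starAsc k ++ [pl 0, st 0] ++ [st 0] ++ plainAsc k ++ [pl 0] ++ [st 0, pl 0] ++ starOddEven k

/-- The word `q_k`, with `x₀` in the role of `x`. -/
def qWord (k : ℕ) : Word :=
  starAsc k ++ [pl 0, st 0] ++ [pl 0] ++ plainAsc k ++ [st 0] ++ [st 0, pl 0] ++ starOddEven k

/-! ### Terms, identities, deducibility, finite bases -/

/-- Terms over `X` in the signature `{·, *}` of involution semigroups. -/
inductive InvTerm
  | var : ℕ → InvTerm
  | mul : InvTerm → InvTerm → InvTerm
  | inv : InvTerm → InvTerm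

/-- Apply a substitution `X → T(X)` to a term. -/
def InvTerm.subst (σ : ℕ → InvTerm) : InvTerm → InvTerm
  | .var n => σ n
  | .mul s t => .mul (s.subst σ) (t.subst σ)
  | .inv s => .inv (s.subst σ)

/-- The value of a term under a substitution `X → S`. -/
def InvTerm.eval {S : Type*} [Semigroup S] [StarMul S] (φ : ℕ → S) : InvTerm → S
  | .var n => φ n
  | .mul s t => s.eval φ * t.eval φ
  | .inv s => star (s.eval φ)

/-- An identity `s ≈ t` between terms. -/
abbrev Identity := InvTerm × InvTerm

/-- The involution semigroup `S` satisfies the identity `e`. -/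
def Satisfies (S : Type*) [Semigroup S] [StarMul S] (e : Identity) : Prop :=
  ∀ φ : ℕ → S, e.1.eval φ = e.2.eval φ

/-- `DirectlyDeducible E s t`: the term `t` arises from `s` by replacing one subterm that is a
substitution instance of a side of some identity in `E` by the same instance of its other side.
Concatenation of terms is associative, so rebracketing a product is always allowed. -/
inductive DirectlyDeducible (E : Set Identity) : InvTerm → InvTerm → Prop
  | instance_left (p q : InvTerm) (σ : ℕ → InvTerm) (h : (p, q) ∈ E) :
      DirectlyDeducible E (p.subst σ) (q.subst σ)
  | instance_right (p q : InvTerm) (σ : ℕ → InvTerm) (h : (p, q) ∈ E) :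
      DirectlyDeducible E (q.subst σ) (p.subst σ)
  | assoc_left (r s t : InvTerm) :
      DirectlyDeducible E (.mul (.mul r s) t) (.mul r (.mul s t))
  | assoc_right (r s t : InvTerm) :
      DirectlyDeducible E (.mul r (.mul s t)) (.mul (.mul r s) t)
  | mul_left (s t r : InvTerm) (h : DirectlyDeducible E s t) :
      DirectlyDeducible E (.mul s r) (.mul t r)
  | mul_right (s t r : InvTerm) (h : DirectlyDeducible E s t) :
      DirectlyDeducible E (.mul r s) (.mul r t)
  | inv (s t : InvTerm) (h : DirectlyDeducible E s t) :
      DirectlyDeducible E (.inv s) (.inv t)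

/-- The identity `e` is deducible from `E`: there is a finite sequence of terms from one side to
the other whose consecutive members are directly deducible from `E`. -/
def Deducible (E : Set Identity) (e : Identity) : Prop :=
  Relation.ReflTransGen (DirectlyDeducible E) e.1 e.2

/-- `E` is an identity basis for the involution semigroup `S`. -/
def IsIdentityBasis (S : Type*) [Semigroup S] [StarMul S] (E : Set Identity) : Prop :=
  (∀ e ∈ E, Satisfies S e) ∧ ∀ e : Identity, Satisfies S e → Deducible E e

/-- The involution semigroup `S` has a finite identity basis. -/
def FinitelyBased (S : Type*) [Semigroup S] [StarMul S] : Prop :=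
  ∃ E : Set Identity, E.Finite ∧ IsIdentityBasis S E

/-! ### The Baxter monoid of rank `n` and Schützenberger's involution -/

section Trees

variable {α : Type*} [LinearOrder α]

/-- Insertion of a symbol into a right strict binary search tree. -/
def insR (a : α) : BinaryTree α → BinaryTree α
  | .nil => .node a .nil .nil
  | .node x l r => if x < a then .node x l (insR a r) else .node x (insR a l) r

/-- Insertion of a symbol into a left strict binary search tree. -/
def insL (a : α) : BinaryTree α → BinaryTree α
  | .nil => .node a .nil .nil
  | .node x l r => if a < x then .node x (insL a l) r else .node x l (insL a r)

/-- The right strict binary search tree of a word, read from right to left. -/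
def treeR (w : List α) : BinaryTree α := w.foldr insR .nil

/-- The left strict binary search tree of a word, read from left to right. -/
def treeL (w : List α) : BinaryTree α := w.foldl (fun T a => insL a T) .nil

/-- The pair of binary search trees that the Baxter insertion attaches to a word. -/
def baxterP (w : List α) : BinaryTree α × BinaryTree α := (treeL w, treeR w)

/-- Auxiliary: the part of a search tree with labels at most `x`. -/
def trimLE (x : α) : BinaryTree α → BinaryTree α
  | .nil => .nil
  | .node y l r => if y ≤ x then .node y l (trimLE x r) else trimLE x l

/-- Auxiliary: the part of a search tree with labels greater than `x`. -/
def trimGT (x : α) : BinaryTree α → BinaryTree α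
  | .nil => .nil
  | .node y l r => if x < y then .node y (trimGT x l) r else trimGT x r

theorem trimLE_insR (x a : α) (T : BinaryTree α) :
    trimLE x (insR a T) = if a ≤ x then insR a (trimLE x T) else trimLE x T := by
  induction T with
  | nil => by_cases h : a ≤ x <;> simp [insR, trimLE, h]
  | node y l r ihl ihr =>
    grind [insR, trimLE]

theorem trimGT_insR (x a : α) (T : BinaryTree α) :
    trimGT x (insR a T) = if x < a then insR a (trimGT x T) else trimGT x T := by
  induction T with
  | nil => by_cases h : x < a <;> simp [insR, trimGT, h]
  | node y l r ihl ihr =>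
    grind [insR, trimGT]

theorem treeR_filter_le (x : α) (u : List α) :
    treeR (u.filter (fun a => a ≤ x)) = trimLE x (treeR u) := by
  induction u with
  | nil => rfl
  | cons a u ih =>
    have h : treeR (a :: u) = insR a (treeR u) := rfl
    rw [h, trimLE_insR, ← ih]
    by_cases h3 : a ≤ x <;> simp [h3, treeR]

theorem treeR_filter_gt (x : α) (u : List α) :
    treeR (u.filter (fun a => x < a)) = trimGT x (treeR u) := by
  induction u with
  | nil => rfl
  | cons a u ih =>
    have h : treeR (a :: u) = insR a (treeR u) := rfl
    rw [h, trimGT_insR, ← ih]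
    by_cases h3 : x < a <;> simp [h3, treeR]

theorem foldr_insR_node (x : α) (l r : BinaryTree α) (u : List α) :
    u.foldr insR (.node x l r) =
      .node x ((u.filter (fun a => a ≤ x)).foldr insR l)
        ((u.filter (fun a => x < a)).foldr insR r) := by
  induction u with
  | nil => rfl
  | cons a u ih =>
    rw [List.foldr_cons, ih]
    by_cases h : x < a
    · simp [insR, h]
    · simp [insR, h, not_lt.mp h]

theorem foldr_insR_congr (T : BinaryTree α) (u v : List α) (h : treeR u = treeR v) :
    u.foldr insR T = v.foldr insR T := by
  induction T generalizing u v with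
  | nil => exact h
  | node x l r ihl ihr =>
    have hl := ihl (u.filter (fun a => a ≤ x)) (v.filter (fun a => a ≤ x))
      (by rw [treeR_filter_le, treeR_filter_le, h])
    have hr := ihr (u.filter (fun a => x < a)) (v.filter (fun a => x < a))
      (by rw [treeR_filter_gt, treeR_filter_gt, h])
    rw [foldr_insR_node, foldr_insR_node, hl, hr]

theorem treeR_append_congr (u v w z : List α) (h₁ : treeR u = treeR v) (h₂ : treeR w = treeR z) :
    treeR (u ++ w) = treeR (v ++ z) := by
  have e : ∀ s t : List α, treeR (s ++ t) = s.foldr insR (treeR t) := fun s t => by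
    simp [treeR, List.foldr_append]
  rw [e, e, h₂]
  exact foldr_insR_congr _ _ _ h₁

end Trees

variable {n : ℕ}

/-- Reversal of a word together with the order-reversing permutation `i ↦ n + 1 - i` of the
alphabet `{1 < ⋯ < n}` (which is `Fin.rev` on `Fin n`). -/
def sharp (w : List (Fin n)) : List (Fin n) := (w.map Fin.rev).reverse

/-- Auxiliary: mirror a tree and reverse its labels. -/
def mirror : BinaryTree (Fin n) → BinaryTree (Fin n)
  | .nil => .nil
  | .node x l r => .node x.rev (mirror r) (mirror l)

theorem mirror_insR (a : Fin n) (T : BinaryTree (Fin n)) :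
    mirror (insR a T) = insL a.rev (mirror T) := by
  induction T with
  | nil => rfl
  | node x l r ihl ihr => by_cases h : x < a <;> simp [insR, insL, mirror, h, ihl, ihr]

theorem mirror_mirror (T : BinaryTree (Fin n)) : mirror (mirror T) = T := by
  induction T with
  | nil => rfl
  | node x l r ihl ihr => simp [mirror, ihl, ihr]

theorem sharp_sharp (w : List (Fin n)) : sharp (sharp w) = w := by
  simp [sharp, Function.comp_def]

theorem sharp_append (u v : List (Fin n)) : sharp (u ++ v) = sharp v ++ sharp u := by
  simp [sharp]

theorem treeL_sharp (w : List (Fin n)) : treeL (sharp w) = mirror (treeR w) := by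
  induction w with
  | nil => rfl
  | cons a w ih =>
    have h : treeR (a :: w) = insR a (treeR w) := rfl
    rw [h, mirror_insR, ← ih]
    simp [sharp, treeL, List.foldl_append]

theorem treeR_sharp (w : List (Fin n)) : treeR (sharp w) = mirror (treeL w) := by
  rw [← mirror_mirror (treeR (sharp w)), ← treeL_sharp, sharp_sharp]

theorem treeL_eq_iff (u v : List (Fin n)) :
    treeL u = treeL v ↔ treeR (sharp u) = treeR (sharp v) := by
  rw [treeR_sharp, treeR_sharp]
  exact ⟨fun h => by rw [h], fun h => by rw [← mirror_mirror (treeL u), h, mirror_mirror]⟩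

theorem baxterP_sharp (u v : List (Fin n)) (h : baxterP u = baxterP v) :
    baxterP (sharp u) = baxterP (sharp v) := by
  obtain ⟨h₁, h₂⟩ := Prod.mk.inj h
  exact Prod.ext (by simp only [baxterP, treeL_sharp, h₂]) (by simp only [baxterP, treeR_sharp, h₁])

theorem baxterP_append (u v w z : List (Fin n)) (h : baxterP u = baxterP v)
    (k : baxterP w = baxterP z) : baxterP (u ++ w) = baxterP (v ++ z) := by
  obtain ⟨h₁, h₂⟩ := Prod.mk.inj h
  obtain ⟨k₁, k₂⟩ := Prod.mk.inj k
  refine Prod.ext ?_ (treeR_append_congr _ _ _ _ h₂ k₂)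
  refine (treeL_eq_iff _ _).2 ?_
  rw [sharp_append, sharp_append]
  exact treeR_append_congr _ _ _ _ ((treeL_eq_iff _ _).1 k₁) ((treeL_eq_iff _ _).1 h₁)

/-- The Baxter congruence on the free monoid over `{1 < ⋯ < n}`: two words are related exactly
when Baxter insertion gives the same pair of trees. -/
def baxterCon (n : ℕ) : Con (FreeMonoid (Fin n)) where
  r u v := baxterP u.toList = baxterP v.toList
  iseqv := ⟨fun _ => rfl, fun h => h.symm, fun h k => h.trans k⟩
  mul' := fun {u v w z} h k => by
    rw [FreeMonoid.toList_mul, FreeMonoid.toList_mul]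
    exact baxterP_append _ _ _ _ h k

/-- The Baxter monoid `baxt_n` of rank `n`. -/
def Baxt (n : ℕ) : Type := (baxterCon n).Quotient

instance (n : ℕ) : Monoid (Baxt n) := inferInstanceAs (Monoid (baxterCon n).Quotient)

/-- The class in `baxt_n` of a word over `{1 < ⋯ < n}`. -/
def Baxt.mk (w : List (Fin n)) : Baxt n := ((FreeMonoid.ofList w : FreeMonoid (Fin n)) :
  (baxterCon n).Quotient)

theorem Baxt.mk_eq_mk (u v : List (Fin n)) : Baxt.mk u = Baxt.mk v ↔ baxterP u = baxterP v :=
  (baxterCon n).eq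

theorem Baxt.mk_append (u v : List (Fin n)) : Baxt.mk (u ++ v) = Baxt.mk u * Baxt.mk v := rfl

/-- Schützenberger's involution on `baxt_n`. -/
def Baxt.sharp (a : Baxt n) : Baxt n :=
  Con.liftOn (c := baxterCon n) a (fun w => Baxt.mk (BaxterInv.sharp w.toList))
    (fun _ _ h => (Baxt.mk_eq_mk _ _).2 (baxterP_sharp _ _ h))

theorem Baxt.sharp_mk (w : List (Fin n)) : (Baxt.mk w).sharp = Baxt.mk (BaxterInv.sharp w) := rfl

theorem Baxt.exists_mk (a : Baxt n) : ∃ w : List (Fin n), Baxt.mk w = a :=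
  Con.induction_on (c := baxterCon n) a (fun w => ⟨w.toList, rfl⟩)

instance (n : ℕ) : StarMul (Baxt n) where
  star := Baxt.sharp
  star_involutive a := by
    obtain ⟨w, rfl⟩ := a.exists_mk
    rw [Baxt.sharp_mk, Baxt.sharp_mk, sharp_sharp]
  star_mul a b := by
    obtain ⟨u, rfl⟩ := a.exists_mk
    obtain ⟨v, rfl⟩ := b.exists_mk
    rw [← Baxt.mk_append, Baxt.sharp_mk, Baxt.sharp_mk, Baxt.sharp_mk, sharp_append,
      Baxt.mk_append]

end BaxterInv

open BaxterInv

namespace BaxterInv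

/-! ### Words under substitution and inversion -/

/-! (A) In a word `u` equivalent to `p_k` every plain `xᵢ`, `1 ≤ i ≤ 2k`, occurs once, and (III)
leaves two shapes for `u[x₀, xᵢ]`: `pBlock i` and `qBlock i`. They already differ in their
`x₀`-letters, so all `i` have the same shape. A deduction of `p_k ≈ q_k` therefore has a step that
changes the shape for all `i` at once (`restrict_eq_pBlock_of_wordStep`).

Let this step apply `s ≈ t`, where `s` has fewer than `2k` letters. The change alters the number of
`x₀*` on either side of each `xᵢ`, so every `xᵢ` lies in the image of `s`, and by pigeonhole the
image of one letter `y` of `s` contains two of them. The letters before the first occurrence of `y`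
or `y*` are determined up to permutation (`exists_perm_prefix`), and dually after the last one, so
this `y` is neither first nor last. A second `y` would duplicate `xᵢ`; hence `y*` occurs on both
sides. The image of `y` has a factor `xᵢ xₗ`, so `u` has factors `xₗ* xᵢ*` to the left and to the
right of it. The initial part of `p_k` forces `i = l + 1`, and its final part, in odd-even order,
forbids it (`false_of_two_star_factors`). So no bound on the length of identities suffices
(`false_of_wordStep_pBlock_qBlock`).

(B) Condition (I) holds in `baxt_3` because symbols may be permuted freely when a context already
inserted separates them (`treeR_append_eq_of_perm`). The other conditions follow from three
invariants of the left-to-right tree: multiplicities, the root, and `leadCount`. They are applied to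
substitutions of single symbols, where `♯` swaps `0` and `2` and fixes `1`; claims about the right
end follow by applying the involution. -/

theorem Letter.inv_inv (a : Letter) : a.inv.inv = a := by
  simp [Letter.inv]

theorem Letter.eq_or_eq_inv {a b : Letter} (h : a.1 = b.1) : a = b ∨ a = b.inv := by
  rcases a with ⟨m, _ | _⟩ <;> rcases b with ⟨n, _ | _⟩ <;> simp_all [Letter.inv]

/-- The word `u*`. -/
def winv (u : Word) : Word := (u.map Letter.inv).reverse

theorem winv_winv (u : Word) : winv (winv u) = u := by
  simp [winv, Function.comp_def, Letter.inv_inv]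

theorem winv_append (u v : Word) : winv (u ++ v) = winv v ++ winv u := by
  simp [winv]

theorem winv_cons (a : Letter) (v : Word) : winv (a :: v) = winv v ++ [a.inv] := by
  simp [winv]

theorem mem_winv {a : Letter} {u : Word} : a ∈ winv u ↔ a.inv ∈ u := by
  simp only [winv, List.mem_reverse, List.mem_map]
  constructor
  · rintro ⟨b, hb, rfl⟩
    rwa [Letter.inv_inv]
  · exact fun h => ⟨_, h, Letter.inv_inv a⟩

/-- The image of a variable of `X ∪ X*` under a substitution of words for the elements of `X`. -/
def letterSubst (σ : ℕ → Word) (a : Letter) : Word := if a.2 then winv (σ a.1) else σ a.1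

/-- The image of a word under a substitution. -/
def wsubst (σ : ℕ → Word) (u : Word) : Word := u.flatMap (letterSubst σ)

theorem letterSubst_inv (σ : ℕ → Word) (a : Letter) :
    letterSubst σ a.inv = winv (letterSubst σ a) := by
  rcases a with ⟨n, _ | _⟩ <;> simp [letterSubst, Letter.inv, winv_winv]

theorem wsubst_append (σ : ℕ → Word) (u v : Word) :
    wsubst σ (u ++ v) = wsubst σ u ++ wsubst σ v := by
  simp [wsubst]

theorem wsubst_cons (σ : ℕ → Word) (a : Letter) (v : Word) :
    wsubst σ (a :: v) = letterSubst σ a ++ wsubst σ v := by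
  simp [wsubst]

theorem wsubst_winv (σ : ℕ → Word) (u : Word) : wsubst σ (winv u) = winv (wsubst σ u) := by
  induction u with
  | nil => rfl
  | cons a u ih =>
    rw [winv_cons, wsubst_append, wsubst_cons, wsubst_cons, winv_append, ih, letterSubst_inv]
    simp [wsubst]

theorem letterSubst_ne_nil {σ : ℕ → Word} (hσ : ∀ n, σ n ≠ []) (a : Letter) :
    letterSubst σ a ≠ [] := by
  have := hσ a.1
  unfold letterSubst
  split <;> simpa [winv]

theorem wsubst_ne_nil {σ : ℕ → Word} (hσ : ∀ n, σ n ≠ []) {u : Word} (hu : u ≠ []) :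
    wsubst σ u ≠ [] := by
  obtain ⟨a, l, rfl⟩ := List.exists_cons_of_ne_nil hu
  rw [wsubst_cons]
  simp [letterSubst_ne_nil hσ a]

section Eval

variable {M : Type*} [Monoid M] [StarMul M]

theorem eval_append (φ : ℕ → M) (u v : Word) :
    Word.eval φ (u ++ v) = Word.eval φ u * Word.eval φ v := by
  simp [Word.eval]

theorem eval_cons (φ : ℕ → M) (a : Letter) (v : Word) :
    Word.eval φ (a :: v) = (if a.2 then star (φ a.1) else φ a.1) * Word.eval φ v := by
  simp [Word.eval]

theorem eval_nil (φ : ℕ → M) : Word.eval φ [] = 1 := rfl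

theorem eval_winv (φ : ℕ → M) (u : Word) : Word.eval φ (winv u) = star (Word.eval φ u) := by
  induction u with
  | nil => simp [winv, Word.eval]
  | cons a u ih =>
    rw [winv_cons, eval_append, eval_cons, eval_cons, eval_nil, ih]
    rcases a with ⟨n, _ | _⟩ <;> simp [Letter.inv]

theorem eval_wsubst (φ : ℕ → M) (σ : ℕ → Word) (u : Word) :
    Word.eval φ (wsubst σ u) = Word.eval (fun n => Word.eval φ (σ n)) u := by
  induction u with
  | nil => rfl
  | cons a u ih =>
    rw [wsubst_cons, eval_append, eval_cons, ih]
    rcases a with ⟨n, _ | _⟩ <;> simp [letterSubst, eval_winv]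

/-- Erasing a variable amounts to evaluating it at the unit of `M`. This is how identities pass to
two-variable restrictions, although substitutions by words must be nonempty. -/
theorem eval_filter (φ : ℕ → M) (p : ℕ → Bool) (u : Word) :
    Word.eval φ (u.filter (fun c => p c.1)) = Word.eval (fun n => if p n then φ n else 1) u := by
  induction u with
  | nil => rfl
  | cons a u ih =>
    rw [eval_cons, ← ih, List.filter_cons]
    by_cases h : p a.1 = true
    · simp [h, eval_cons]
    · simp [h]

theorem SatisfiesWord.symm {u v : Word} (h : SatisfiesWord M u v) : SatisfiesWord M v u :=
  ⟨h.2.1, h.1, fun φ => (h.2.2 φ).symm⟩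

theorem SatisfiesWord.trans {u v w : Word} (h : SatisfiesWord M u v) (k : SatisfiesWord M v w) :
    SatisfiesWord M u w :=
  ⟨h.1, k.2.1, fun φ => (h.2.2 φ).trans (k.2.2 φ)⟩

theorem SatisfiesWord.winv {u v : Word} (h : SatisfiesWord M u v) :
    SatisfiesWord M (winv u) (winv v) :=
  ⟨by simpa [BaxterInv.winv] using h.1, by simpa [BaxterInv.winv] using h.2.1,
    fun φ => by rw [eval_winv, eval_winv, h.2.2]⟩

theorem SatisfiesWord.wsubst {u v : Word} (h : SatisfiesWord M u v) {σ : ℕ → Word}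
    (hσ : ∀ n, σ n ≠ []) : SatisfiesWord M (wsubst σ u) (wsubst σ v) :=
  ⟨wsubst_ne_nil hσ h.1, wsubst_ne_nil hσ h.2.1, fun φ => by rw [eval_wsubst, eval_wsubst, h.2.2]⟩

theorem SatisfiesWord.restrict {u v : Word} (h : SatisfiesWord M u v) (x y : Letter)
    (hu : restrict u x y ≠ []) (hv : restrict v x y ≠ []) :
    SatisfiesWord M (restrict u x y) (restrict v x y) :=
  ⟨hu, hv, fun φ => by
    have e : ∀ w : Word, Word.eval φ (BaxterInv.restrict w x y) =
        Word.eval (fun n => if (decide (n = x.1 ∨ n = y.1)) then φ n else 1) w :=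
      fun w => eval_filter φ (fun n => decide (n = x.1 ∨ n = y.1)) w
    rw [e, e, h.2.2]⟩

end Eval

/-! ### Lists -/

/-- The right-hand factorisation shows that `x` occurs only once in the common list, so nothing need
be assumed of `a` and `b`. -/
theorem append_cons_inj_of_notMem_right {α : Type*} {x : α} {a b a' b' : List α}
    (h : a ++ x :: b = a' ++ x :: b') (ha : x ∉ a') (hb : x ∉ b') : a = a' ∧ b = b' := by
  rcases List.append_eq_append_iff.1 h with ⟨c, rfl, hc⟩ | ⟨c, rfl, hc⟩
  · rcases c with _ | ⟨d, c⟩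
    · simpa using hc
    · simp only [List.cons_append, List.cons.injEq] at hc
      simp [hc.1] at ha
  · rcases c with _ | ⟨d, c⟩
    · simpa using hc.symm
    · simp only [List.cons_append, List.cons.injEq] at hc
      simp [hc.2] at hb

theorem append_cons_inj_of_forall_not {α : Type*} {p : α → Prop} {x y : α} {a b a' b' : List α}
    (h : a ++ x :: b = a' ++ y :: b') (ha : ∀ c ∈ a, ¬ p c) (ha' : ∀ c ∈ a', ¬ p c)
    (hx : p x) (hy : p y) : a = a' ∧ x = y ∧ b = b' := by
  rcases List.append_eq_append_iff.1 h with ⟨c, rfl, hc⟩ | ⟨c, rfl, hc⟩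
  · rcases c with _ | ⟨d, c⟩
    · simpa using hc
    · simp only [List.cons_append, List.cons.injEq] at hc
      exact absurd hx (by rw [hc.1]; exact ha' _ (by simp))
  · rcases c with _ | ⟨d, c⟩
    · simpa [eq_comm] using hc
    · simp only [List.cons_append, List.cons.injEq] at hc
      exact absurd hy (by rw [hc.1]; exact ha _ (by simp))

theorem exists_first_split {α : Type*} (p : α → Prop) (l : List α) (h : ∃ c ∈ l, p c) :
    ∃ a x b, l = a ++ x :: b ∧ (∀ c ∈ a, ¬ p c) ∧ p x := by
  classical
  induction l with
  | nil => simp at h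
  | cons d l ih =>
    by_cases hd : p d
    · exact ⟨[], d, l, rfl, by simp, hd⟩
    · obtain ⟨a, x, b, rfl, ha, hx⟩ := ih (by
        obtain ⟨c, hc, hp⟩ := h
        rcases List.mem_cons.1 hc with rfl | hc
        · exact absurd hp hd
        · exact ⟨c, hc, hp⟩)
      exact ⟨d :: a, x, b, rfl, by simpa [hd] using ha, hx⟩

theorem filter_eq_nil_of_forall {α : Type*} {p : α → Bool} {l : List α} (h : ∀ c ∈ l, p c = false) :
    l.filter p = [] := by
  simpa using h

/-! ### Initial and final parts -/

theorem initialPart_filter (p : ℕ → Bool) (u : Word) :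
    initialPart (u.filter (fun c => p c.1)) = (initialPart u).filter (fun c => p c.1) := by
  induction u with
  | nil => rfl
  | cons a u ih =>
    by_cases h : p a.1 = true
    · simp [h, initialPart, ih, List.filter_filter, Bool.and_comm]
    · rw [List.filter_cons_of_neg (by simpa using h), ih, initialPart,
        List.filter_cons_of_neg (by simpa using h), List.filter_filter]
      refine List.filter_congr fun b _ => ?_
      by_cases hb : b.1 = a.1 <;> simp_all

theorem initialPart_append (u v : Word) :
    initialPart (u ++ v) =
      initialPart u ++ (initialPart v).filter (fun c => c.1 ∉ u.map Prod.fst) := by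
  induction u with
  | nil => simp [initialPart]
  | cons a u ih =>
    rw [List.cons_append, initialPart, ih, initialPart, List.filter_append, List.filter_filter]
    simp only [List.cons_append, List.cons.injEq, true_and, List.append_cancel_left_eq]
    refine List.filter_congr fun b _ => ?_
    by_cases hb : b.1 = a.1 <;> simp [hb]

theorem initialPart_of_nodup {u : Word} (h : (u.map Prod.fst).Nodup) : initialPart u = u := by
  induction u with
  | nil => rfl
  | cons a u ih =>
    rw [List.map_cons, List.nodup_cons] at h
    rw [initialPart, ih h.2, List.filter_eq_self.2]
    intro b hb
    have : b.1 ≠ a.1 := fun e => h.1 (List.mem_map.2 ⟨b, hb, e⟩)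
    simpa using this

theorem head?_initialPart (u : Word) : (initialPart u).head? = u.head? := by
  cases u <;> rfl

theorem nodup_initialPart (u : Word) : ((initialPart u).map Prod.fst).Nodup := by
  induction u with
  | nil => simp [initialPart]
  | cons a u ih =>
    rw [initialPart, List.map_cons, List.nodup_cons]
    refine ⟨by simp, ?_⟩
    exact (List.filter_sublist.map _).nodup ih

theorem initialPart_map_inv (u : Word) :
    initialPart (u.map Letter.inv) = (initialPart u).map Letter.inv := by
  induction u with
  | nil => rfl
  | cons a u ih =>
    rw [List.map_cons, initialPart, ih, initialPart, List.map_cons, List.filter_map]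
    rfl

theorem initialPart_winv (u : Word) : initialPart (winv u) = winv (finalPart u) := by
  rw [winv, ← List.map_reverse, initialPart_map_inv, winv, finalPart, List.map_reverse,
    List.reverse_reverse]

theorem filter_head_eq_of_initialPart_eq {u v : Word} (h : initialPart u = initialPart v)
    (p : ℕ → Bool) :
    (u.filter (fun c => p c.1)).head? = (v.filter (fun c => p c.1)).head? := by
  rw [← head?_initialPart, initialPart_filter, h, ← initialPart_filter, head?_initialPart]

/-! ### Terms as words, deductions between words -/

/-- The word that a term denotes. -/
def InvTerm.toWord : InvTerm → Word
  | .var n => [pl n]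
  | .mul s t => s.toWord ++ t.toWord
  | .inv s => winv s.toWord

theorem InvTerm.toWord_ne_nil (t : InvTerm) : t.toWord ≠ [] := by
  induction t with
  | var n => simp [toWord]
  | mul s t ihs iht => simp [toWord, ihs]
  | inv s ih => simpa [toWord, winv] using ih

theorem InvTerm.toWord_subst (σ : ℕ → InvTerm) (t : InvTerm) :
    (t.subst σ).toWord = wsubst (fun n => (σ n).toWord) t.toWord := by
  induction t with
  | var n => simp [toWord, subst, wsubst, letterSubst]
  | mul s t ihs iht => rw [subst, toWord, toWord, wsubst_append, ihs, iht]
  | inv s ih => rw [subst, toWord, toWord, wsubst_winv, ih]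

theorem InvTerm.eval_eq {M : Type*} [Monoid M] [StarMul M] (φ : ℕ → M) (t : InvTerm) :
    t.eval φ = Word.eval φ t.toWord := by
  induction t with
  | var n => simp [toWord, eval, Word.eval]
  | mul s t ihs iht => rw [eval, toWord, eval_append, ihs, iht]
  | inv s ih => rw [eval, toWord, eval_winv, ih]

/-- A term denoting the variable `a`. -/
def InvTerm.ofLetter (a : Letter) : InvTerm := if a.2 then .inv (.var a.1) else .var a.1

/-- A term denoting a nonempty word. -/
def InvTerm.ofWord : Word → InvTerm
  | [] => .var 0
  | [a] => ofLetter a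
  | a :: b :: u => .mul (ofLetter a) (ofWord (b :: u))

theorem InvTerm.toWord_ofLetter (a : Letter) : (ofLetter a).toWord = [a] := by
  rcases a with ⟨n, _ | _⟩ <;> simp [ofLetter, toWord, winv, Letter.inv]

theorem InvTerm.toWord_ofWord {u : Word} (hu : u ≠ []) : (ofWord u).toWord = u := by
  induction u with
  | nil => exact absurd rfl hu
  | cons a u ih =>
    cases u with
    | nil => exact toWord_ofLetter a
    | cons b u => rw [ofWord, toWord, ih (by simp), toWord_ofLetter]; rfl

theorem satisfies_iff {M : Type*} [Monoid M] [StarMul M] (e : Identity) :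
    Satisfies M e ↔ SatisfiesWord M e.1.toWord e.2.toWord := by
  simp only [Satisfies, SatisfiesWord, InvTerm.eval_eq, ne_eq, InvTerm.toWord_ne_nil,
    not_false_eq_true, true_and]

/-- `v` arises from `u` by one application of a word identity of `M` whose left side is shorter
than `m`. -/
def WordStep (M : Type*) [Monoid M] [StarMul M] (m : ℕ) (u v : Word) : Prop :=
  ∃ (s t c d : Word) (σ : ℕ → Word), SatisfiesWord M s t ∧ s.length < m ∧ (∀ n, σ n ≠ []) ∧
    u = c ++ wsubst σ s ++ d ∧ v = c ++ wsubst σ t ++ d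

section WordStep

variable {M : Type*} [Monoid M] [StarMul M] {m : ℕ} {u v : Word}

theorem WordStep.append_left (h : WordStep M m u v) (w : Word) :
    WordStep M m (w ++ u) (w ++ v) := by
  obtain ⟨s, t, c, d, σ, hst, hs, hσ, rfl, rfl⟩ := h
  exact ⟨s, t, w ++ c, d, σ, hst, hs, hσ, by simp, by simp⟩

theorem WordStep.append_right (h : WordStep M m u v) (w : Word) :
    WordStep M m (u ++ w) (v ++ w) := by
  obtain ⟨s, t, c, d, σ, hst, hs, hσ, rfl, rfl⟩ := h
  exact ⟨s, t, c, d ++ w, σ, hst, hs, hσ, by simp, by simp⟩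

theorem WordStep.winv (h : WordStep M m u v) : WordStep M m (winv u) (winv v) := by
  obtain ⟨s, t, c, d, σ, hst, hs, hσ, rfl, rfl⟩ := h
  refine ⟨BaxterInv.winv s, BaxterInv.winv t, BaxterInv.winv d, BaxterInv.winv c, σ, hst.winv,
    by simpa [BaxterInv.winv] using hs, hσ, ?_, ?_⟩ <;>
  simp [winv_append, wsubst_winv]

theorem WordStep.eval_eq (h : WordStep M m u v) (φ : ℕ → M) : Word.eval φ u = Word.eval φ v := by
  obtain ⟨s, t, c, d, σ, hst, -, -, rfl, rfl⟩ := h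
  simp only [eval_append, eval_wsubst, hst.2.2]

end WordStep

/-- Rebracketing leaves the denoted word unchanged. A replacement under a star is again a step,
since it applies the starred identity `winv s ≈ winv t`, whose sides have the same lengths. -/
theorem DirectlyDeducible.toWord {M : Type*} [Monoid M] [StarMul M] {m : ℕ} {E : Set Identity}
    (hE : ∀ e ∈ E, Satisfies M e) (hm : ∀ e ∈ E, e.1.toWord.length < m ∧ e.2.toWord.length < m)
    {s t : InvTerm} (h : DirectlyDeducible E s t) :
    s.toWord = t.toWord ∨ WordStep M m s.toWord t.toWord := by
  induction h with
  | instance_left p q σ h =>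
    exact .inr ⟨_, _, [], [], _, (satisfies_iff _).1 (hE _ h), (hm _ h).1,
      fun n => (σ n).toWord_ne_nil, by simp [InvTerm.toWord_subst], by simp [InvTerm.toWord_subst]⟩
  | instance_right p q σ h =>
    exact .inr ⟨_, _, [], [], _, ((satisfies_iff _).1 (hE _ h)).symm, (hm _ h).2,
      fun n => (σ n).toWord_ne_nil, by simp [InvTerm.toWord_subst], by simp [InvTerm.toWord_subst]⟩
  | assoc_left r s t => left; simp [InvTerm.toWord]
  | assoc_right r s t => left; simp [InvTerm.toWord]
  | mul_left s t r _ ih =>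
    rcases ih with e | e
    · left; simp [InvTerm.toWord, e]
    · exact .inr (e.append_right _)
  | mul_right s t r _ ih =>
    rcases ih with e | e
    · left; simp [InvTerm.toWord, e]
    · exact .inr (e.append_left _)
  | inv s t _ ih =>
    rcases ih with e | e
    · left; simp [InvTerm.toWord, e]
    · exact .inr e.winv

/-- A finitely based involution monoid admits, for every large `m`, deductions between the two
sides of each of its word identities whose steps apply identities with sides shorter than `m`. -/
theorem FinitelyBased.exists_wordStep {M : Type*} [Monoid M] [StarMul M] (h : FinitelyBased M) :
    ∃ m₀ : ℕ, ∀ m, m₀ ≤ m → ∀ u v : Word, SatisfiesWord M u v →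
      Relation.ReflTransGen (WordStep M m) u v := by
  obtain ⟨E, hfin, hE, hb⟩ := h
  obtain ⟨b, hb'⟩ := (hfin.image fun e : Identity =>
    e.1.toWord.length + e.2.toWord.length).bddAbove
  refine ⟨b + 1, fun m hm u v huv => ?_⟩
  have hm' : ∀ e ∈ E, e.1.toWord.length < m ∧ e.2.toWord.length < m := fun e he => by
    have : e.1.toWord.length + e.2.toWord.length ≤ b := hb' (Set.mem_image_of_mem _ he)
    omega
  have key : ∀ s t : InvTerm, Relation.ReflTransGen (DirectlyDeducible E) s t →
      Relation.ReflTransGen (WordStep M m) s.toWord t.toWord := by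
    intro s t hst
    induction hst with
    | refl => exact .refl
    | tail _ h ih =>
      rcases h.toWord hE hm' with e | e
      · rwa [← e]
      · exact ih.tail e
  have := key _ _ (hb (InvTerm.ofWord u, InvTerm.ofWord v)
    ((satisfies_iff _).2 (by simpa [InvTerm.toWord_ofWord huv.1, InvTerm.toWord_ofWord huv.2.1])))
  rwa [InvTerm.toWord_ofWord huv.1, InvTerm.toWord_ofWord huv.2.1] at this

/-! ### Prefixes and suffixes at a variable -/

theorem mem_letterSubst_triple {b z : Letter} {c : Letter} :
    c ∈ letterSubst (fun n => if n = z.1 then [z, z, z.inv] else [pl n]) b →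
      c.1 = b.1 := by
  rcases b with ⟨n, _ | _⟩ <;> by_cases h : n = z.1 <;>
    simp [letterSubst, h, winv, Letter.inv] <;> rintro (h | h) <;> simp_all

theorem mem_wsubst_triple {u : Word} {z : Letter} {c : Letter}
    (h : c ∈ wsubst (fun n => if n = z.1 then [z, z, z.inv] else [pl n]) u) :
    ∃ b ∈ u, c.1 = b.1 := by
  obtain ⟨b, hb, hc⟩ := List.mem_flatMap.1 h
  exact ⟨b, hb, mem_letterSubst_triple hc⟩

/-- The matrix with rows `(2, 1)` and `(1, 2)` is invertible, so the counts of `xₙ` and `xₙ*` can be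
recovered after the substitution. The shorter `xₙ ↦ xₙ xₙ*` would retain only their sum. -/
theorem count_wsubst_triple (u : Word) (n : ℕ) :
    (wsubst (fun i => if i = n then [pl n, pl n, st n] else [pl i]) u).count (pl n) =
        2 * u.count (pl n) + u.count (st n) ∧
      (wsubst (fun i => if i = n then [pl n, pl n, st n] else [pl i]) u).count (st n) =
        u.count (pl n) + 2 * u.count (st n) := by
  induction u with
  | nil => simp [wsubst]
  | cons a u ih =>
    rw [wsubst_cons, List.count_append, List.count_append, ih.1, ih.2]
    rcases a with ⟨m, _ | _⟩ <;> by_cases h : m = n <;>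
      simp [letterSubst, h, winv, Letter.inv] <;> omega

theorem restrict_append (u v : Word) (x y : Letter) :
    restrict (u ++ v) x y = restrict u x y ++ restrict v x y := by
  simp [restrict]

theorem restrict_cons_right (v : Word) (x y : Letter) :
    restrict (y :: v) x y = y :: restrict v x y := by
  simp [restrict]

theorem mem_restrict {u : Word} {x y c : Letter} :
    c ∈ restrict u x y ↔ c ∈ u ∧ (c.1 = x.1 ∨ c.1 = y.1) := by
  simp [restrict]

/-- The word identities of `M` are balanced and preserve initial and final parts. -/
def PreservesParts (M : Type*) [Monoid M] [StarMul M] : Prop :=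
  ∀ u v : Word, SatisfiesWord M u v →
    initialPart u = initialPart v ∧ finalPart u = finalPart v ∧ BalancedIdentity u v

/-- The word identities of `M` preserve, up to permutation, the part of `u[x, y]` before the first
occurrence of `y`, if it consists of occurrences of both `x` and `x*`. -/
def PreservesPrefixes (M : Type*) [Monoid M] [StarMul M] : Prop :=
  ∀ u v : Word, SatisfiesWord M u v → ∀ x y : Letter, x.1 ≠ y.1 → ∀ a r : Word,
    (∀ c : Letter, c ∈ a ↔ c = x ∨ c = x.inv) → restrict u x y = a ++ [y] ++ r →
      ∃ a' r' : Word, a'.Perm a ∧ restrict v x y = a' ++ [y] ++ r'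

section Prefix

variable {M : Type*} [Monoid M] [StarMul M]

/-- Condition (IV) speaks only of prefixes that contain both `x` and `x*`. The substitution `xₙ ↦ xₙ
xₙ xₙ*` makes both occur as soon as one does, and the original counts are then recovered linearly.
-/
theorem count_prefix_eq_of_mem (hIV : PreservesPrefixes M) {s₁ s₂ t₁ t₂ : Word} {y : Letter}
    (h : SatisfiesWord M (s₁ ++ y :: s₂) (t₁ ++ y :: t₂)) (hs : ∀ c ∈ s₁, c.1 ≠ y.1)
    (ht : ∀ c ∈ t₁, c.1 ≠ y.1) {n : ℕ} (hn : ∃ c ∈ s₁, c.1 = n) :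
    s₁.count (pl n) = t₁.count (pl n) ∧ s₁.count (st n) = t₁.count (st n) := by
  have hny : n ≠ y.1 := by
    obtain ⟨c, hc, rfl⟩ := hn
    exact hs c hc
  set σ : ℕ → Word := fun i => if i = n then [pl n, pl n, st n] else [pl i] with hσ
  have hy : letterSubst σ y = [y] := by
    rcases y with ⟨m, _ | _⟩ <;> simp [hσ, letterSubst, hny.symm, winv, Letter.inv]
  have hsat := h.wsubst (σ := σ) (fun i => by by_cases hi : i = n <;> simp [hσ, hi])
  have hsplit : ∀ w₁ w₂ : Word, restrict (wsubst σ (w₁ ++ y :: w₂)) (pl n) y =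
      restrict (wsubst σ w₁) (pl n) y ++ [y] ++ restrict (wsubst σ w₂) (pl n) y := fun w₁ w₂ => by
    rw [wsubst_append, wsubst_cons, hy, restrict_append, List.singleton_append,
      restrict_cons_right]
    simp
  have hmem : ∀ {w c}, c ∈ wsubst σ w → ∃ b ∈ w, c.1 = b.1 := fun h =>
    mem_wsubst_triple (z := pl n) h
  have hcon : ∀ c : Letter, c ∈ restrict (wsubst σ s₁) (pl n) y ↔ c = pl n ∨ c = (pl n).inv := by
    intro c
    rw [mem_restrict]
    constructor
    · rintro ⟨hc, hc' | hc'⟩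
      · rcases c with ⟨m, _ | _⟩ <;> simp_all [Letter.inv]
      · obtain ⟨b, hb, hcb⟩ := hmem hc
        exact absurd (hcb.symm.trans hc') (hs b hb)
    · obtain ⟨b, hb, rfl⟩ := hn
      rintro (rfl | rfl)
      · refine ⟨List.mem_flatMap.2 ⟨b, hb, ?_⟩, by simp⟩
        rcases b with ⟨m, _ | _⟩ <;> simp [hσ, letterSubst, winv, Letter.inv]
      · refine ⟨List.mem_flatMap.2 ⟨b, hb, ?_⟩, by simp [Letter.inv]⟩
        rcases b with ⟨m, _ | _⟩ <;> simp [hσ, letterSubst, winv, Letter.inv]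
  obtain ⟨a', r', hperm, hv⟩ := hIV _ _ hsat (pl n) y hny _ _ hcon (hsplit s₁ s₂)
  rw [hsplit, List.append_assoc, List.append_assoc] at hv
  have h1 := (append_cons_inj_of_forall_not (p := fun c : Letter => c.1 = y.1) hv
    (by
      intro c hc hcy
      obtain ⟨b, hb, hcb⟩ := hmem (mem_restrict.1 hc).1
      exact ht b hb (hcb.symm.trans hcy))
    (by
      intro c hc hcy
      rcases (hcon c).1 (hperm.mem_iff.1 hc) with rfl | rfl
      · exact hny hcy
      · exact hny hcy) rfl rfl).1
  have hcount : ∀ (w : Word) (c : Letter), c.1 = n →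
      (restrict w (pl n) y).count c = w.count c := fun w c hc =>
    List.count_filter (by simp [hc])
  have e1 := hperm.count_eq (pl n)
  have e2 := hperm.count_eq (st n)
  rw [← h1, hcount _ _ rfl, hcount _ _ rfl] at e1 e2
  rw [(count_wsubst_triple _ n).1, (count_wsubst_triple _ n).1] at e1
  rw [(count_wsubst_triple _ n).2, (count_wsubst_triple _ n).2] at e2
  omega

/-- In both sides of an identity of `M`, the first occurrence of `y` or `y*` is preceded by the
same letters with the same multiplicities. -/
theorem exists_perm_prefix (hII : PreservesParts M) (hIV : PreservesPrefixes M)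
    {s₁ s₂ t : Word} {y : Letter}
    (h : SatisfiesWord M (s₁ ++ y :: s₂) t) (hs : ∀ c ∈ s₁, c.1 ≠ y.1) :
    ∃ t₁ t₂, t = t₁ ++ y :: t₂ ∧ s₁.Perm t₁ := by
  obtain ⟨hip, -, hbal⟩ := hII _ _ h
  have hyt : y ∈ t := by
    rw [← List.count_pos_iff, ← hbal y]
    exact List.count_pos_iff.2 (by simp)
  obtain ⟨t₁, y', t₂, rfl, ht, hy'⟩ := exists_first_split (fun c : Letter => c.1 = y.1) t
    ⟨y, hyt, rfl⟩
  -- The first occurrence found in `t` might be `y*` instead of `y`; equality of initial parts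
  -- excludes this.
  have hhead := filter_head_eq_of_initialPart_eq hip (fun n => decide (n = y.1))
  have e : ∀ (w₁ w₂ : Word) (z : Letter), (∀ c ∈ w₁, c.1 ≠ y.1) → z.1 = y.1 →
      ((w₁ ++ z :: w₂).filter (fun c => decide (c.1 = y.1))).head? = some z := by
    intro w₁ w₂ z hw hz
    rw [List.filter_append, filter_eq_nil_of_forall (by simpa using hw)]
    simp [hz]
  rw [e _ _ _ hs rfl, e _ _ _ ht hy'] at hhead
  obtain rfl : y = y' := by simpa using hhead
  refine ⟨t₁, t₂, rfl, List.perm_iff_count.2 ?_⟩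
  have key : ∀ n : ℕ, s₁.count (pl n) = t₁.count (pl n) ∧ s₁.count (st n) = t₁.count (st n) := by
    intro n
    by_cases h1 : ∃ c ∈ s₁, c.1 = n
    · exact count_prefix_eq_of_mem hIV h hs ht h1
    by_cases h2 : ∃ c ∈ t₁, c.1 = n
    · have := count_prefix_eq_of_mem hIV h.symm ht hs h2
      exact ⟨this.1.symm, this.2.symm⟩
    have z : ∀ w : Word, (¬ ∃ c ∈ w, c.1 = n) → ∀ b, w.count (n, b) = 0 := fun w hw b =>
      List.count_eq_zero.2 fun hm => hw ⟨_, hm, rfl⟩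
    exact ⟨(z _ h1 _).trans (z _ h2 _).symm, (z _ h1 _).trans (z _ h2 _).symm⟩
  rintro ⟨n, _ | _⟩
  exacts [(key n).1, (key n).2]

/-- The involution reverses words, so this is the prefix statement for the starred identity and
`y*`. -/
theorem exists_perm_suffix (hII : PreservesParts M) (hIV : PreservesPrefixes M)
    {s₁ s₂ t : Word} {y : Letter}
    (h : SatisfiesWord M (s₁ ++ y :: s₂) t) (hs : ∀ c ∈ s₂, c.1 ≠ y.1) :
    ∃ t₁ t₂, t = t₁ ++ y :: t₂ ∧ s₂.Perm t₂ := by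
  have h' := h.winv
  rw [winv_append, winv_cons, List.append_assoc, List.singleton_append] at h'
  obtain ⟨t₁, t₂, ht, hp⟩ := exists_perm_prefix hII hIV h' (y := y.inv)
    (fun c hc => show c.inv.1 ≠ y.1 from hs _ (mem_winv.1 hc))
  refine ⟨winv t₂, winv t₁, ?_, ?_⟩
  · rw [← winv_winv t, ht, winv_append, winv_cons, Letter.inv_inv]
    simp
  · have := (hp.map Letter.inv).trans (List.reverse_perm _).symm
    rw [← winv_winv s₂]
    exact (List.reverse_perm _).trans this

end Prefix

/-! ### The words `p_k` and `q_k` -/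

/-- The restriction of `p_k` to `x₀` and `xᵢ`. -/
def pBlock (i : ℕ) : Word := [st i, pl 0, st 0, st 0, pl i, pl 0, st 0, pl 0, st i]

/-- The restriction of `q_k` to `x₀` and `xᵢ`. -/
def qBlock (i : ℕ) : Word := [st i, pl 0, st 0, pl 0, pl i, st 0, st 0, pl 0, st i]

theorem map_fst_starAsc (k : ℕ) : (starAsc k).map Prod.fst = (List.range (2 * k)).map (· + 1) := by
  simp [starAsc]

theorem map_fst_plainAsc (k : ℕ) :
    (plainAsc k).map Prod.fst = (List.range (2 * k)).map (· + 1) := by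
  simp [plainAsc]

theorem map_fst_starOddEven (k : ℕ) : (starOddEven k).map Prod.fst =
    (List.range k).map (fun i => 2 * i + 1) ++ (List.range k).map (fun i => 2 * i + 2) := by
  simp [starOddEven, Function.comp_def]

theorem nodup_fst_starAsc (k : ℕ) : ((starAsc k).map Prod.fst).Nodup := by
  rw [map_fst_starAsc]
  exact List.nodup_range.map (fun a b h => by simpa using h)

theorem nodup_fst_plainAsc (k : ℕ) : ((plainAsc k).map Prod.fst).Nodup := by
  rw [map_fst_plainAsc]
  exact List.nodup_range.map (fun a b h => by simpa using h)

theorem nodup_fst_starOddEven (k : ℕ) : ((starOddEven k).map Prod.fst).Nodup := by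
  rw [map_fst_starOddEven, List.nodup_append]
  refine ⟨List.nodup_range.map (fun a b h => by simpa using h),
    List.nodup_range.map (fun a b h => by simpa using h), ?_⟩
  intro a ha b hb
  simp only [List.mem_map, List.mem_range] at ha hb
  omega

theorem mem_starAsc {k : ℕ} {c : Letter} : c ∈ starAsc k ↔ c.2 = true ∧ 1 ≤ c.1 ∧ c.1 ≤ 2 * k := by
  rcases c with ⟨n, b⟩
  simp only [starAsc, List.mem_map, List.mem_range, Prod.mk.injEq]
  constructor
  · rintro ⟨a, ha, rfl, rfl⟩
    simp; omega
  · rintro ⟨rfl, h1, h2⟩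
    exact ⟨n - 1, by omega, by omega, rfl⟩

theorem mem_plainAsc {k : ℕ} {c : Letter} :
    c ∈ plainAsc k ↔ c.2 = false ∧ 1 ≤ c.1 ∧ c.1 ≤ 2 * k := by
  rcases c with ⟨n, b⟩
  simp only [plainAsc, List.mem_map, List.mem_range, Prod.mk.injEq]
  constructor
  · rintro ⟨a, ha, rfl, rfl⟩
    simp; omega
  · rintro ⟨rfl, h1, h2⟩
    exact ⟨n - 1, by omega, by omega, rfl⟩

theorem mem_starOddEven {k : ℕ} {c : Letter} :
    c ∈ starOddEven k ↔ c.2 = true ∧ 1 ≤ c.1 ∧ c.1 ≤ 2 * k := by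
  rcases c with ⟨n, b⟩
  simp only [starOddEven, List.mem_append, List.mem_map, List.mem_range, Prod.mk.injEq]
  constructor
  · rintro (⟨a, ha, rfl, rfl⟩ | ⟨a, ha, rfl, rfl⟩) <;> (simp; omega)
  · rintro ⟨rfl, h1, h2⟩
    rcases Nat.even_or_odd n with ⟨m, hm⟩ | ⟨m, hm⟩
    · exact .inr ⟨m - 1, by omega, by omega, rfl⟩
    · exact .inl ⟨m, by omega, by omega, rfl⟩

theorem restrict_eq_singleton {l : Word} (hl : (l.map Prod.fst).Nodup) (h0 : ∀ c ∈ l, c.1 ≠ 0)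
    {a : Letter} (ha : a ∈ l) : restrict l (pl 0) (pl a.1) = [a] := by
  have hnd : l.Nodup := List.Nodup.of_map _ hl
  refine List.perm_singleton.1 ((List.perm_ext_iff_of_nodup (hnd.filter _) (by simp)).2 ?_)
  intro b
  simp only [List.mem_filter, decide_eq_true_eq, List.mem_singleton]
  constructor
  · rintro ⟨hb, h | h⟩
    · exact absurd h (h0 b hb)
    · exact List.inj_on_of_nodup_map hl hb ha h
  · rintro rfl
    exact ⟨ha, .inr rfl⟩

section Blocks

variable {k i : ℕ}

theorem restrict_pWord_and_qWord (h1 : 1 ≤ i) (h2 : i ≤ 2 * k) :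
    restrict (pWord k) (pl 0) (pl i) = pBlock i ∧ restrict (qWord k) (pl 0) (pl i) = qBlock i := by
  have a1 : restrict (starAsc k) (pl 0) (pl i) = [st i] :=
    restrict_eq_singleton (nodup_fst_starAsc k) (fun c hc => by have := mem_starAsc.1 hc; omega)
      (a := st i) (mem_starAsc.2 ⟨rfl, h1, h2⟩)
  have a2 : restrict (plainAsc k) (pl 0) (pl i) = [pl i] :=
    restrict_eq_singleton (nodup_fst_plainAsc k) (fun c hc => by have := mem_plainAsc.1 hc; omega)
      (a := pl i) (mem_plainAsc.2 ⟨rfl, h1, h2⟩)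
  have a3 : restrict (starOddEven k) (pl 0) (pl i) = [st i] :=
    restrict_eq_singleton (nodup_fst_starOddEven k)
      (fun c hc => by have := mem_starOddEven.1 hc; omega)
      (a := st i) (mem_starOddEven.2 ⟨rfl, h1, h2⟩)
  constructor
  · simp only [pWord, restrict_append, a1, a2, a3]
    simp [restrict, pBlock]
  · simp only [qWord, restrict_append, a1, a2, a3]
    simp [restrict, qBlock]

theorem index_le_of_mem_pWord {c : Letter} (hc : c ∈ pWord k) : c.1 ≤ 2 * k := by
  simp only [pWord, List.mem_append, mem_starAsc, mem_plainAsc, mem_starOddEven, List.mem_cons,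
    List.not_mem_nil, or_false] at hc
  rcases hc with (((((h | rfl | rfl) | rfl) | h) | rfl) | rfl | rfl) | h <;> simp_all

/-- In `ip p_k`, the only pairs of adjacent letters with positive indices are `xⱼ* xⱼ₊₁*`. -/
theorem eq_succ_of_infix_initialPart {i j : ℕ} (hi : 1 ≤ i) (hi' : i ≤ 2 * k) {a b : Word}
    (h : initialPart (pWord k) = a ++ st j :: st i :: b) : i = j + 1 := by
  have e : pWord k = starAsc k ++ ([pl 0, st 0] ++ [st 0] ++ plainAsc k ++ [pl 0] ++
      [st 0, pl 0] ++ starOddEven k) := by simp [pWord]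
  rw [e, initialPart_append, initialPart_of_nodup (nodup_fst_starAsc k)] at h
  set X := (initialPart _).filter (fun c => c.1 ∉ (starAsc k).map Prod.fst) with hX
  -- All of `x₁*, …, x₂ₖ*` already occur in `starAsc k`, so the pair lies inside that prefix.
  have hnot : st i ∉ X := by
    intro hm
    have := (List.mem_filter.1 hm).2
    simp only [map_fst_starAsc, decide_eq_true_eq, List.mem_map, List.mem_range] at this
    exact this ⟨i - 1, by omega, by omega⟩
  have h' : starAsc k ++ X = (a ++ [st j]) ++ st i :: b := by simpa using h
  obtain ⟨c, hc⟩ : ∃ c, starAsc k = a ++ st j :: st i :: c := by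
    rcases List.append_eq_append_iff.1 h' with ⟨c, hc1, hc2⟩ | ⟨c, hc1, hc2⟩
    · exact absurd (hc2 ▸ by simp) hnot
    · rcases c with _ | ⟨d, c⟩
      · exact absurd ((List.nil_append X ▸ hc2) ▸ by simp) hnot
      · simp only [List.cons_append, List.cons.injEq] at hc2
        obtain ⟨rfl, -⟩ := hc2
        exact ⟨c, by simpa using hc1⟩
  have g1 : (starAsc k)[a.length]? = some (st j) := by rw [hc]; simp
  have g2 : (starAsc k)[a.length + 1]? = some (st i) := by rw [hc]; simp
  simp only [starAsc, List.getElem?_map, Option.map_eq_some_iff, Prod.mk.injEq, and_true] at g1 g2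
  obtain ⟨m, hm, rfl⟩ := g1
  obtain ⟨m', hm', rfl⟩ := g2
  obtain ⟨_, hm⟩ := List.getElem?_eq_some_iff.1 hm
  obtain ⟨_, hm'⟩ := List.getElem?_eq_some_iff.1 hm'
  simp at hm hm'
  omega

/-- In `fp p_k`, there is no pair of adjacent letters `xⱼ* xⱼ₊₁*` with `j` positive. -/
theorem ne_succ_of_infix_finalPart (hk : 2 ≤ k) {i j : ℕ} (hj : 1 ≤ j) (hj' : j ≤ 2 * k)
    {a b : Word} (h : finalPart (pWord k) = a ++ st j :: st i :: b) : i ≠ j + 1 := by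
  have e : (pWord k).reverse = (starOddEven k).reverse ++ (starAsc k ++ [pl 0, st 0] ++ [st 0] ++
      plainAsc k ++ [pl 0] ++ [st 0, pl 0]).reverse := by simp [pWord]
  rw [finalPart, e, initialPart_append, initialPart_of_nodup (u := (starOddEven k).reverse) (by
    rw [List.map_reverse]; exact List.nodup_reverse.2 (nodup_fst_starOddEven k))] at h
  set X := (initialPart _).filter (fun c => c.1 ∉ (starOddEven k).reverse.map Prod.fst) with hX
  have hnot : st j ∉ X.reverse := by
    intro hm
    have := (List.mem_filter.1 (List.mem_reverse.1 hm)).2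
    simp only [List.map_reverse, List.mem_reverse, decide_eq_true_eq] at this
    exact this (List.mem_map.2 ⟨st j, mem_starOddEven.2 ⟨rfl, hj, hj'⟩, rfl⟩)
  have h' : X.reverse ++ starOddEven k = a ++ st j :: st i :: b := by simpa using h
  obtain ⟨c, hc⟩ : ∃ c, starOddEven k = c ++ st j :: st i :: b := by
    rcases List.append_eq_append_iff.1 h' with ⟨c, hc1, hc2⟩ | ⟨c, hc1, hc2⟩
    · exact ⟨c, hc2⟩
    · rcases c with _ | ⟨d, c⟩
      · exact ⟨[], by simpa using hc2.symm⟩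
      · simp only [List.cons_append, List.cons.injEq] at hc2
        exact absurd (by rw [hc1, ← hc2.1]; simp) hnot
  have g1 : (starOddEven k)[c.length]? = some (st j) := by rw [hc]; simp
  have g2 : (starOddEven k)[c.length + 1]? = some (st i) := by rw [hc]; simp
  have key : ∀ n m, (starOddEven k)[n]? = some (st m) →
      n < k ∧ m = 2 * n + 1 ∨ k ≤ n ∧ m = 2 * (n - k) + 2 := by
    intro n m hn
    obtain ⟨hlt, hn⟩ := List.getElem?_eq_some_iff.1 hn
    simp only [starOddEven, List.getElem_append, List.length_map, List.length_range,
      List.getElem_map, List.getElem_range] at hn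
    split at hn
    · simp only [Prod.mk.injEq] at hn; omega
    · simp only [Prod.mk.injEq] at hn; omega
  -- Within either half the index grows by two. At the junction it passes from `2k - 1` to `2`,
  -- which is a successor only for `k = 1`.
  have k1 := key _ _ g1
  have k2 := key _ _ g2
  omega

end Blocks

/-! ### Identities with left side `p_k` -/

theorem restrict_split_pBlock {u v : Word} {i : ℕ} (hi : i ≠ 0)
    (h : restrict (u ++ pl i :: v) (pl 0) (pl i) = pBlock i) :
    restrict u (pl 0) (pl i) = [st i, pl 0, st 0, st 0] ∧
      restrict v (pl 0) (pl i) = [pl 0, st 0, pl 0, st i] := by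
  rw [restrict_append, restrict_cons_right] at h
  exact append_cons_inj_of_notMem_right (a' := [st i, pl 0, st 0, st 0])
    (b' := [pl 0, st 0, pl 0, st i]) h (by simp [hi]) (by simp [hi])

theorem restrict_split_qBlock {u v : Word} {i : ℕ} (hi : i ≠ 0)
    (h : restrict (u ++ pl i :: v) (pl 0) (pl i) = qBlock i) :
    restrict u (pl 0) (pl i) = [st i, pl 0, st 0, pl 0] ∧
      restrict v (pl 0) (pl i) = [st 0, st 0, pl 0, st i] := by
  rw [restrict_append, restrict_cons_right] at h
  exact append_cons_inj_of_notMem_right (a' := [st i, pl 0, st 0, pl 0])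
    (b' := [st 0, st 0, pl 0, st i]) h (by simp [hi]) (by simp [hi])

theorem filter_restrict_left (u : Word) (x y : Letter) :
    (restrict u x y).filter (fun c => c.1 = x.1) = u.filter (fun c => c.1 = x.1) := by
  rw [restrict, List.filter_filter]
  refine List.filter_congr fun c _ => ?_
  by_cases h : c.1 = x.1 <;> simp [h]

theorem filter_restrict_right (u : Word) (x y : Letter) :
    (restrict u x y).filter (fun c => c.1 = y.1) = u.filter (fun c => c.1 = y.1) := by
  rw [restrict, List.filter_filter]
  refine List.filter_congr fun c _ => ?_
  by_cases h : c.1 = y.1 <;> simp [h]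

theorem filter_zero_of_pBlock {u v : Word} {i : ℕ} (hi : i ≠ 0)
    (h : restrict (u ++ pl i :: v) (pl 0) (pl i) = pBlock i) :
    u.filter (fun c => c.1 = 0) = [pl 0, st 0, st 0] := by
  have := filter_restrict_left u (pl 0) (pl i)
  rw [(restrict_split_pBlock hi h).1] at this
  rw [← this]
  simp [hi]

theorem mem_of_pBlock {u : Word} {i : ℕ} (h : restrict u (pl 0) (pl i) = pBlock i) : pl i ∈ u :=
  (mem_restrict.1 (h ▸ by simp [pBlock] : pl i ∈ restrict u (pl 0) (pl i))).1

theorem eq_of_split_pBlock {u v u' v' : Word} {i : ℕ} (hi : i ≠ 0)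
    (h : restrict (u ++ pl i :: v) (pl 0) (pl i) = pBlock i)
    (h' : u ++ pl i :: v = u' ++ pl i :: v') : u = u' ∧ v = v' := by
  obtain ⟨h1, h2⟩ := restrict_split_pBlock hi (h' ▸ h)
  refine append_cons_inj_of_notMem_right h' (fun hm => ?_) (fun hm => ?_)
  · have := (mem_restrict (x := pl 0) (y := pl i)).2 ⟨hm, .inr rfl⟩
    rw [h1] at this
    simp [hi] at this
  · have := (mem_restrict (x := pl 0) (y := pl i)).2 ⟨hm, .inr rfl⟩
    rw [h2] at this
    simp [hi] at this

section Core

variable {M : Type*} [Monoid M] [StarMul M] {k : ℕ}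

/-- Every word that forms an identity of `M` with the restriction of `p_k` to two variables is
this word or the corresponding restriction of `q_k`. -/
def RigidBlocks (M : Type*) [Monoid M] [StarMul M] : Prop :=
  ∀ (x y : ℕ) (w : Word), x ≠ y →
    SatisfiesWord M [st y, pl x, st x, st x, pl y, pl x, st x, pl x, st y] w →
    w ≠ [st y, pl x, st x, st x, pl y, pl x, st x, pl x, st y] →
    w = [st y, pl x, st x, pl x, pl y, st x, st x, pl x, st y]

theorem restrict_eq_pBlock_or_qBlock (hII : PreservesParts M) (hIII : RigidBlocks M) {u : Word}
    (hu : SatisfiesWord M (pWord k) u) {i : ℕ} (h1 : 1 ≤ i) (h2 : i ≤ 2 * k) :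
    restrict u (pl 0) (pl i) = pBlock i ∨ restrict u (pl 0) (pl i) = qBlock i := by
  have hp := (restrict_pWord_and_qWord h1 h2).1
  have hmem : pl i ∈ u := by
    rw [← List.count_pos_iff, ← (hII _ _ hu).2.2 (pl i), List.count_pos_iff]
    exact mem_of_pBlock hp
  have hs := hu.restrict (pl 0) (pl i) (by simp [hp, pBlock])
    (List.ne_nil_of_mem (mem_restrict.2 ⟨hmem, .inr rfl⟩))
  rw [hp] at hs
  by_cases h : restrict u (pl 0) (pl i) = pBlock i
  · exact .inl h
  · exact .inr (hIII 0 i _ (by omega) hs h)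

/-- The letter that follows `xᵢ` in a word with the restrictions of `p_k` is some `xₗ`, `l ≠ i`,
provided that it is not to the right of all `xⱼ`. -/
theorem next_letter_of_pBlock {u : Word}
    (hu : ∀ i, 1 ≤ i → i ≤ 2 * k → restrict u (pl 0) (pl i) = pBlock i)
    (hle : ∀ c ∈ u, c.1 ≤ 2 * k) {i j : ℕ} {b : Letter} {e f : Word}
    (hi : 1 ≤ i ∧ i ≤ 2 * k) (hj : 1 ≤ j ∧ j ≤ 2 * k) (he : u = e ++ pl i :: b :: f)
    (hjm : pl j ∈ b :: f) : ∃ l, 1 ≤ l ∧ l ≤ 2 * k ∧ l ≠ i ∧ b = pl l := by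
  have hi0 : i ≠ 0 := by omega
  have hui := hu i hi.1 hi.2
  rw [he] at hui
  have he0 := filter_zero_of_pBlock hi0 hui
  have hbf := (restrict_split_pBlock hi0 hui).2
  have hb2 : b.1 ≤ 2 * k := hle b (by rw [he]; simp)
  have hbi : b.1 ≠ i := by
    intro hb
    rw [restrict, List.filter_cons_of_pos (by simp [hb])] at hbf
    simp only [List.cons.injEq] at hbf
    rw [hbf.1] at hb
    exact hi0 hb.symm
  -- Exactly three letters with index `0` precede each plain `xᵢ`; one more between `xᵢ` and `xⱼ`
  -- would make four before `xⱼ`.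
  have hb0 : b.1 ≠ 0 := by
    intro hb
    have hjf : pl j ∈ f := by
      rcases List.mem_cons.1 hjm with h | h
      · rw [← h] at hb; simp at hb; omega
      · exact h
    obtain ⟨f₁, f₂, rfl⟩ := List.append_of_mem hjf
    have huj := hu j hj.1 hj.2
    have hsplit : u = (e ++ pl i :: b :: f₁) ++ pl j :: f₂ := by simp [he]
    rw [hsplit] at huj
    have h3 := congrArg List.length (filter_zero_of_pBlock (by omega) huj)
    rw [List.filter_append, he0] at h3
    simp [hi0, hb] at h3
  obtain ⟨l, _ | _⟩ := b
  · exact ⟨l, by simp at hb0; omega, hb2, hbi, rfl⟩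
  -- In `pBlock l`, an occurrence of `xₗ*` is preceded by none or by all six of the letters `x₀,
  -- x₀*`, but here it is preceded by three.
  · exfalso
    simp only at hb0 hbi hb2
    have hul := hu l (by omega) hb2
    have hsplit : u = (e ++ [pl i]) ++ st l :: f := by simp [he]
    rw [hsplit, restrict_append, restrict, restrict, List.filter_cons_of_pos (by simp)] at hul
    have h3 := filter_restrict_left (e ++ [pl i]) (pl 0) (pl l)
    rw [List.filter_append, he0] at h3
    change restrict (e ++ [pl i]) (pl 0) (pl l) ++ st l :: restrict f (pl 0) (pl l) = _ at hul
    generalize restrict (e ++ [pl i]) (pl 0) (pl l) = A at hul h3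
    rcases A with _ | ⟨a, A⟩
    · simp [hi0] at h3
    · rw [pBlock, List.cons_append, List.cons.injEq] at hul
      have := append_cons_inj_of_notMem_right (a' := [pl 0, st 0, st 0, pl l, pl 0, st 0, pl 0])
        (b' := []) hul.2 (by simp [hb0]) (by simp)
      rw [this.1, hul.1] at h3
      simp [hi0, hb0] at h3

theorem exists_initialPart_eq_append_pair {a b : Word} {p q : Letter} (hpq : p.1 ≠ q.1)
    (hp : ∀ c ∈ a, c.1 ≠ p.1) (hq : ∀ c ∈ a, c.1 ≠ q.1) :
    ∃ a' b', initialPart (a ++ p :: q :: b) = a' ++ p :: q :: b' := by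
  have hp' : p.1 ∉ a.map Prod.fst := fun h => by
    obtain ⟨c, hc, h⟩ := List.mem_map.1 h
    exact hp c hc h
  have hq' : q.1 ∉ a.map Prod.fst := fun h => by
    obtain ⟨c, hc, h⟩ := List.mem_map.1 h
    exact hq c hc h
  rw [initialPart_append, initialPart, initialPart,
    List.filter_cons_of_pos (by simpa using hp'), List.filter_cons_of_pos (by simpa using hpq.symm),
    List.filter_cons_of_pos (by simpa using hq')]
  exact ⟨_, _, rfl⟩

theorem forall_ne_of_filter_eq_singleton {a b : Word} {p : Letter}
    (h : (a ++ p :: b).filter (fun c => c.1 = p.1) = [p]) :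
    (∀ c ∈ a, c.1 ≠ p.1) ∧ ∀ c ∈ b, c.1 ≠ p.1 := by
  rw [List.filter_append, List.filter_cons_of_pos (by simp)] at h
  obtain ⟨h1, h2⟩ := append_cons_inj_of_notMem_right (a' := []) (b' := []) h (by simp) (by simp)
  exact ⟨by simpa using h1, by simpa using h2⟩

/-- A word with the restrictions and the initial and final parts of `p_k` that contains a factor
`xᵢ xⱼ` has no factor `xⱼ* xᵢ*` both to the left and to the right of it. -/
theorem false_of_two_star_factors (hk : 2 ≤ k) {u : Word}
    (hip : initialPart (pWord k) = initialPart u) (hfp : finalPart (pWord k) = finalPart u)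
    (hu : ∀ i, 1 ≤ i → i ≤ 2 * k → restrict u (pl 0) (pl i) = pBlock i) {i j : ℕ}
    (hi : 1 ≤ i ∧ i ≤ 2 * k) (hj : 1 ≤ j ∧ j ≤ 2 * k) {a b c d : Word}
    (he : u = (a ++ st j :: st i :: b) ++ pl i :: pl j :: (c ++ st j :: st i :: d)) : False := by
  have hij : i ≠ j := by
    rintro rfl
    have := hu i hi.1 hi.2
    rw [he] at this
    have := (restrict_split_pBlock (by omega) this).2
    rw [restrict_cons_right] at this
    simp at this
    omega
  have key : ∀ {l : ℕ} {e f : Word}, 1 ≤ l ∧ l ≤ 2 * k → u = e ++ pl l :: f →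
      e.filter (fun c => c.1 = l) = [st l] ∧ f.filter (fun c => c.1 = l) = [st l] := by
    intro l e f hl hef
    have h := hu l hl.1 hl.2
    have h0 : 0 ≠ l := by omega
    rw [hef] at h
    have h := restrict_split_pBlock (by omega) h
    have h1 := filter_restrict_right e (pl 0) (pl l)
    have h2 := filter_restrict_right f (pl 0) (pl l)
    rw [h.1] at h1
    rw [h.2] at h2
    rw [← h1, ← h2]
    simp [h0]
  have ki := key hi he
  have kj := key hj (e := a ++ st j :: st i :: (b ++ [pl i])) (f := c ++ st j :: st i :: d)
    (by simp [he])
  have i1 := (forall_ne_of_filter_eq_singleton (a := a ++ [st j]) (b := b) (p := st i)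
    (by simpa using ki.1)).1
  have j1 := (forall_ne_of_filter_eq_singleton (p := st j) kj.1).1
  have i2 := (forall_ne_of_filter_eq_singleton (a := pl j :: c ++ [st j]) (b := d) (p := st i)
    (by simpa using ki.2)).2
  have j2 := (forall_ne_of_filter_eq_singleton (p := st j) kj.2).2
  -- The left factor consists of the first occurrences for both indices, so it survives as an
  -- adjacent pair in the initial part.
  have e1 : i = j + 1 := by
    obtain ⟨a', b', h⟩ := exists_initialPart_eq_append_pair (a := a) (p := st j) (q := st i)
      (b := b ++ pl i :: pl j :: (c ++ st j :: st i :: d)) hij.symm j1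
      (fun x hx => i1 x (by simp [hx]))
    refine eq_succ_of_infix_initialPart hi.1 hi.2 (a := a') (b := b') ?_
    rw [hip, ← h, he]
    simp
  -- Dually, read from the right, the other factor consists of the last occurrences and survives in
  -- the final part.
  obtain ⟨a', b', h⟩ := exists_initialPart_eq_append_pair (a := d.reverse) (p := st i) (q := st j)
    (b := (a ++ st j :: st i :: b ++ pl i :: pl j :: c).reverse) hij
    (fun x hx => i2 x (by simpa using hx)) (fun x hx => j2 x (by simp_all))
  refine ne_succ_of_infix_finalPart hk hj.1 hj.2 (i := i) (a := b'.reverse) (b := a'.reverse) ?_ e1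
  have hr : u.reverse = d.reverse ++ st i :: st j ::
      (a ++ st j :: st i :: b ++ pl i :: pl j :: c).reverse := by
    simp [he]
  rw [hfp, finalPart, hr, h]
  simp

end Core

/-! ### The sufficient condition -/

section Sufficient

variable {M : Type*} [Monoid M] [StarMul M] {k : ℕ}

/-- Among more indices than letters of `s`, two are covered by the image of the same letter of
`s`. -/
theorem exists_letter_covering_two {s : Word} {σ : ℕ → Word} {N : ℕ} (hs : s.length < N)
    (h : ∀ i, 1 ≤ i → i ≤ N → pl i ∈ wsubst σ s) :
    ∃ y ∈ s, ∃ i j g r, (1 ≤ i ∧ i ≤ N) ∧ (1 ≤ j ∧ j ≤ N) ∧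
      letterSubst σ y = g ++ pl i :: r ∧ pl j ∈ r := by
  have h' : ∀ i, ∃ y, i ∈ Finset.Icc 1 N → y ∈ s ∧ pl i ∈ letterSubst σ y := by
    intro i
    by_cases hi : i ∈ Finset.Icc 1 N
    · obtain ⟨y, hy⟩ := List.mem_flatMap.1 (h i (Finset.mem_Icc.1 hi).1 (Finset.mem_Icc.1 hi).2)
      exact ⟨y, fun _ => hy⟩
    · exact ⟨pl 0, fun hi' => absurd hi' hi⟩
  choose f hf using h'
  obtain ⟨i, hi, j, hj, hij, hfij⟩ := Finset.exists_ne_map_eq_of_card_lt_of_maps_to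
    (s := Finset.Icc 1 N) (t := s.toFinset) (f := f)
    (by simpa using (List.toFinset_card_le s).trans_lt hs)
    (fun i hi => by simpa using (hf i (by simpa using hi)).1)
  have hyi := hf i hi
  have hyj := hf j hj
  rw [← hfij] at hyj
  refine ⟨f i, hyi.1, ?_⟩
  obtain ⟨g, r, hgr⟩ := List.append_of_mem hyi.2
  have hjm := hyj.2
  rw [hgr, List.mem_append, List.mem_cons] at hjm
  rcases hjm with hjm | hjm | hjm
  · obtain ⟨g₁, g₂, rfl⟩ := List.append_of_mem hjm
    exact ⟨j, i, g₁, g₂ ++ pl i :: r, Finset.mem_Icc.1 hj, Finset.mem_Icc.1 hi, by simp [hgr],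
      by simp⟩
  · simp only [Prod.mk.injEq, and_true] at hjm
    exact absurd hjm.symm hij
  · exact ⟨i, j, g, r, Finset.mem_Icc.1 hi, Finset.mem_Icc.1 hj, hgr, hjm⟩

theorem false_of_wordStep_pBlock_qBlock (hII : PreservesParts M) (hIV : PreservesPrefixes M)
    (hk : 2 ≤ k) {u v : Word} (hpu : SatisfiesWord M (pWord k) u)
    (hu : ∀ i, 1 ≤ i → i ≤ 2 * k → restrict u (pl 0) (pl i) = pBlock i)
    (hv : ∀ i, 1 ≤ i → i ≤ 2 * k → restrict v (pl 0) (pl i) = qBlock i)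
    (h : WordStep M (2 * k) u v) : False := by
  obtain ⟨s, t, c, d, σ, hst, hs, hσ, hcu, hcv⟩ := h
  -- Before `xᵢ` the letter `x₀*` occurs twice in `pBlock i` and once in `qBlock i`; after it, once
  -- and twice.
  have left_ne : ∀ {i e f e' f'}, 1 ≤ i ∧ i ≤ 2 * k → u = e ++ pl i :: f → v = e' ++ pl i :: f' →
      ¬ e.Perm e' := by
    intro i e f e' f' hi he he' hp
    have h1 := hu i hi.1 hi.2
    have h2 := hv i hi.1 hi.2
    rw [he] at h1
    rw [he'] at h2
    have := (hp.filter (fun c => c.1 = (pl 0).1 ∨ c.1 = (pl i).1)).count_eq (st 0)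
    change (restrict e (pl 0) (pl i)).count _ = (restrict e' (pl 0) (pl i)).count _ at this
    rw [(restrict_split_pBlock (by omega) h1).1, (restrict_split_qBlock (by omega) h2).1] at this
    have hi0 : i ≠ 0 := by omega
    simp [hi0] at this
  have right_ne : ∀ {i e f e' f'}, 1 ≤ i ∧ i ≤ 2 * k → u = e ++ pl i :: f →
      v = e' ++ pl i :: f' → ¬ f.Perm f' := by
    intro i e f e' f' hi he he' hp
    have h1 := hu i hi.1 hi.2
    have h2 := hv i hi.1 hi.2
    rw [he] at h1
    rw [he'] at h2
    have := (hp.filter (fun c => c.1 = (pl 0).1 ∨ c.1 = (pl i).1)).count_eq (st 0)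
    change (restrict f (pl 0) (pl i)).count _ = (restrict f' (pl 0) (pl i)).count _ at this
    rw [(restrict_split_pBlock (by omega) h1).2, (restrict_split_qBlock (by omega) h2).2] at this
    have hi0 : i ≠ 0 := by omega
    simp [hi0] at this
  -- An `xᵢ` inside `c` would keep its prefix, and one inside `d` its suffix.
  have hcover : ∀ i, 1 ≤ i → i ≤ 2 * k → pl i ∈ wsubst σ s := by
    intro i h1 h2
    have hm := mem_of_pBlock (hu i h1 h2)
    rw [hcu, List.mem_append, List.mem_append] at hm
    rcases hm with (hm | hm) | hm
    · obtain ⟨e, f, rfl⟩ := List.append_of_mem hm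
      refine absurd (List.Perm.refl e) (left_ne ⟨h1, h2⟩ (f := f ++ wsubst σ s ++ d)
        (f' := f ++ wsubst σ t ++ d) ?_ ?_)
      · rw [hcu]; simp
      · rw [hcv]; simp
    · exact hm
    · obtain ⟨e, f, rfl⟩ := List.append_of_mem hm
      refine absurd (List.Perm.refl f) (right_ne ⟨h1, h2⟩ (e := c ++ wsubst σ s ++ e)
        (e' := c ++ wsubst σ t ++ e) ?_ ?_)
      · rw [hcu]; simp
      · rw [hcv]; simp
  obtain ⟨y, hy, i, j, g, r, hi, hj, hyg, hjr⟩ := exists_letter_covering_two hs hcover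
  obtain ⟨s₁, s₂, rfl⟩ := List.append_of_mem hy
  have split_at : ∀ w₁ w₂ : Word, c ++ wsubst σ (w₁ ++ y :: w₂) ++ d =
      (c ++ wsubst σ w₁ ++ g) ++ pl i :: (r ++ wsubst σ w₂ ++ d) := fun w₁ w₂ => by
    rw [wsubst_append, wsubst_cons, hyg]
    simp
  -- If `y` is a first occurrence in `s`, then `t` has a `y` preceded by a permutation of `s₁`, so
  -- the prefixes of `xᵢ` in `u` and `v` are permutations of each other.
  by_cases h1 : ∀ z ∈ s₁, z.1 ≠ y.1
  · obtain ⟨t₁, t₂, rfl, hp⟩ := exists_perm_prefix hII hIV hst h1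
    exact left_ne hi (hcu.trans (split_at _ _)) (hcv.trans (split_at _ _))
      (((hp.flatMap_right _).append_left c).append_right g)
  by_cases h2 : ∀ z ∈ s₂, z.1 ≠ y.1
  · obtain ⟨t₁, t₂, rfl, hp⟩ := exists_perm_suffix hII hIV hst h2
    exact right_ne hi (hcu.trans (split_at _ _)) (hcv.trans (split_at _ _))
      (((hp.flatMap_right _).append_left r).append_right d)
  push Not at h1 h2
  obtain ⟨z₁, hz₁, hzy₁⟩ := h1
  obtain ⟨z₂, hz₂, hzy₂⟩ := h2
  have hle : ∀ b ∈ u, b.1 ≤ 2 * k := fun b hb => by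
    rw [← List.count_pos_iff, ← (hII _ _ hpu).2.2 b, List.count_pos_iff] at hb
    exact index_le_of_mem_pWord hb
  obtain ⟨b, r, rfl⟩ := List.exists_cons_of_ne_nil (List.ne_nil_of_mem hjr)
  have hcu' := hcu.trans (split_at _ _)
  obtain ⟨l, hl1, hl2, hli, rfl⟩ := next_letter_of_pBlock hu hle hi hj
    (e := c ++ wsubst σ s₁ ++ g) (b := b) (f := r ++ wsubst σ s₂ ++ d) (by simpa using hcu') (by
      rw [List.append_assoc, ← List.cons_append]
      exact List.mem_append_left _ hjr)
  have unique : ∀ {e f}, u = e ++ pl i :: f → e = c ++ wsubst σ s₁ ++ g ∧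
      f = pl l :: r ++ wsubst σ s₂ ++ d := fun {e f} he =>
    eq_of_split_pBlock (by omega) (he ▸ hu i hi.1 hi.2) (he.symm.trans hcu')
  have hinv : letterSubst σ y.inv = winv r ++ st l :: st i :: winv g := by
    rw [letterSubst_inv, hyg, winv_append, winv_cons, winv_cons]
    simp [Letter.inv]
  -- An earlier letter `z₁ = y` would give a second occurrence of `xᵢ` in `u`, at a different
  -- position; so `z₁ = y*`, whose image contains `xₗ* xᵢ*`.
  have star₁ : ∃ a b, c ++ wsubst σ s₁ ++ g = a ++ st l :: st i :: b := by
    obtain ⟨p₁, p₂, rfl⟩ := List.append_of_mem hz₁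
    rcases Letter.eq_or_eq_inv hzy₁ with rfl | rfl
    · have := (unique (e := c ++ wsubst σ p₁ ++ g)
        (f := pl l :: r ++ wsubst σ (p₂ ++ z₁ :: s₂) ++ d) (by
          rw [hcu]; simp [wsubst_append, wsubst_cons, hyg])).1
      have := congrArg List.length this
      simp [wsubst_append, wsubst_cons, hyg] at this
    · refine ⟨c ++ wsubst σ p₁ ++ winv r, winv g ++ wsubst σ p₂ ++ g, ?_⟩
      rw [wsubst_append, wsubst_cons, hinv]
      simp
  have star₂ : ∃ a b, r ++ wsubst σ s₂ ++ d = a ++ st l :: st i :: b := by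
    obtain ⟨p₁, p₂, rfl⟩ := List.append_of_mem hz₂
    rcases Letter.eq_or_eq_inv hzy₂ with rfl | rfl
    · have := (unique (e := c ++ wsubst σ (s₁ ++ z₂ :: p₁) ++ g)
        (f := pl l :: r ++ wsubst σ p₂ ++ d) (by
          rw [hcu]; simp [wsubst_append, wsubst_cons, hyg])).1
      have := congrArg List.length this
      simp [wsubst_append, wsubst_cons, hyg] at this
    · refine ⟨r ++ wsubst σ p₁ ++ winv r, winv g ++ wsubst σ p₂ ++ d, ?_⟩
      rw [wsubst_append, wsubst_cons, hinv]
      simp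
  obtain ⟨a, b, hab⟩ := star₁
  obtain ⟨a', b', hab'⟩ := star₂
  refine false_of_two_star_factors hk (hII _ _ hpu).1 (hII _ _ hpu).2.1 hu hi ⟨hl1, hl2⟩
    (a := a) (b := b) (c := a') (d := b') ?_
  rw [← hab, ← hab', hcu']
  simp

theorem restrict_eq_pBlock_of_wordStep (hII : PreservesParts M) (hIII : RigidBlocks M)
    (hIV : PreservesPrefixes M) (hk : 2 ≤ k) {u v : Word} (hpu : SatisfiesWord M (pWord k) u)
    (hpv : SatisfiesWord M (pWord k) v)
    (hu : ∀ i, 1 ≤ i → i ≤ 2 * k → restrict u (pl 0) (pl i) = pBlock i)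
    (h : WordStep M (2 * k) u v) :
    ∀ i, 1 ≤ i → i ≤ 2 * k → restrict v (pl 0) (pl i) = pBlock i := by
  by_contra! hcon
  obtain ⟨i, hi1, hi2, hi⟩ := hcon
  have hq := (restrict_eq_pBlock_or_qBlock hII hIII hpv hi1 hi2).resolve_left hi
  refine false_of_wordStep_pBlock_qBlock hII hIV hk hpu hu (fun j hj1 hj2 => ?_) h
  -- The subword of `v` on `x₀, x₀*` does not depend on the chosen index, and it distinguishes the
  -- two shapes. One `qBlock` thus forces all the others.
  refine (restrict_eq_pBlock_or_qBlock hII hIII hpv hj1 hj2).resolve_left fun hp => ?_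
  have e1 := filter_restrict_left v (pl 0) (pl i)
  rw [← filter_restrict_left v (pl 0) (pl j), hp, hq] at e1
  have hi0 : i ≠ 0 := by omega
  have hj0 : j ≠ 0 := by omega
  simp [pBlock, qBlock, hi0, hj0] at e1

/-- A sufficient condition for an involution monoid to be non-finitely based. -/
theorem not_finitelyBased_of_conditions
    (hI : ∀ k : ℕ, 2 ≤ k → SatisfiesWord M (pWord k) (qWord k)) (hII : PreservesParts M)
    (hIII : RigidBlocks M) (hIV : PreservesPrefixes M) : ¬ FinitelyBased M := by
  intro hfb
  obtain ⟨m, hm⟩ := hfb.exists_wordStep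
  -- The choice `k = m + 2` gives both `2 ≤ k` and `m ≤ 2k`.
  have hk : 2 ≤ m + 2 := by omega
  have hchain := hm (2 * (m + 2)) (by omega) _ _ (hI (m + 2) hk)
  have hself : SatisfiesWord M (pWord (m + 2)) (pWord (m + 2)) :=
    ⟨(hI _ hk).1, (hI _ hk).1, fun _ => rfl⟩
  have key : ∀ u, Relation.ReflTransGen (WordStep M (2 * (m + 2))) (pWord (m + 2)) u →
      SatisfiesWord M (pWord (m + 2)) u ∧
        ∀ i, 1 ≤ i → i ≤ 2 * (m + 2) → restrict u (pl 0) (pl i) = pBlock i := by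
    intro u hu
    induction hu with
    | refl => exact ⟨hself, fun i h1 h2 => (restrict_pWord_and_qWord h1 h2).1⟩
    | @tail b c _ hbc ih =>
      have hc : SatisfiesWord M (pWord (m + 2)) c := by
        refine ⟨hself.1, ?_, fun φ => (ih.1.2.2 φ).trans (hbc.eval_eq φ)⟩
        obtain ⟨s, t, e, f, σ, hst, -, hσ, -, rfl⟩ := hbc
        simp [wsubst_ne_nil hσ hst.2.1]
      exact ⟨hc, restrict_eq_pBlock_of_wordStep hII hIII hIV hk ih.1 hc ih.2 hbc⟩
  have h1 := (key _ hchain).2 1 le_rfl (by omega)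
  rw [(restrict_pWord_and_qWord le_rfl (by omega)).2] at h1
  simp [pBlock, qBlock] at h1

end Sufficient

/-! ### Equal pairs of search trees -/

section SearchTrees

variable {α : Type*} [LinearOrder α]

theorem treeR_append_singleton (w : List α) (x : α) :
    treeR (w ++ [x]) = .node x (treeR (w.filter (fun a => a ≤ x)))
      (treeR (w.filter (fun a => x < a))) := by
  have : treeR (w ++ [x]) = w.foldr insR (.node x .nil .nil) := by simp [treeR, insR]
  rw [this, foldr_insR_node]
  rfl

/-- Symbols in front of a word that separates any two of them may be permuted. -/
theorem treeR_append_eq_of_perm {u v s : List α} (h : u.Perm v)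
    (hs : ∀ a ∈ u, ∀ b ∈ u, a < b → ∃ x ∈ s, a ≤ x ∧ x < b) : treeR (u ++ s) = treeR (v ++ s) := by
  induction hn : s.length using Nat.strong_induction_on generalizing u v s with
  | _ n ih =>
    rcases List.eq_nil_or_concat s with rfl | ⟨s, x, rfl⟩
    · have hc : ∀ a ∈ u, ∀ b ∈ u, a = b := by
        intro a ha b hb
        rcases lt_trichotomy a b with hab | hab | hab
        · simpa using hs a ha b hb hab
        · exact hab
        · simpa using hs b hb a ha hab
      rcases u with _ | ⟨a, u⟩
      · rw [h.nil_eq]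
      · have e : a :: u = List.replicate (a :: u).length a :=
          List.eq_replicate_of_mem fun b hb => hc b hb a (by simp)
        rw [e] at h
        rw [e, List.perm_replicate.1 h.symm]
    · rw [List.concat_eq_append] at hs hn ⊢
      -- The last symbol `x` is inserted first and is the root. Two symbols on the same side of it
      -- have their separator on that side too, and the separator is not `x` itself, so induction
      -- applies to both subtrees.
      rw [← List.append_assoc, ← List.append_assoc, treeR_append_singleton, treeR_append_singleton]
      simp only [List.filter_append]
      rw [List.length_append, List.length_singleton] at hn
      have hl : ∀ p : α → Bool, (s.filter p).length < n := fun p =>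
        (List.length_filter_le _ _).trans_lt (by omega)
      congr 1
      · refine ih _ (hl _) (h.filter _) (fun a ha b hb hab => ?_) rfl
        simp only [List.mem_filter, decide_eq_true_eq] at ha hb
        obtain ⟨y, hy, hay, hyb⟩ := hs a ha.1 b hb.1 hab
        have hyx := hyb.trans_le hb.2
        rcases List.mem_append.1 hy with hy | hy
        · exact ⟨y, by simp [hy, hyx.le], hay, hyb⟩
        · exact absurd (List.mem_singleton.1 hy) hyx.ne
      · refine ih _ (hl _) (h.filter _) (fun a ha b hb hab => ?_) rfl
        simp only [List.mem_filter, decide_eq_true_eq] at ha hb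
        obtain ⟨y, hy, hay, hyb⟩ := hs a ha.1 b hb.1 hab
        have hyx := ha.2.trans_le hay
        rcases List.mem_append.1 hy with hy | hy
        · exact ⟨y, by simp [hy, hyx], hay, hyb⟩
        · exact absurd (List.mem_singleton.1 hy) hyx.ne'

theorem treeL_append_singleton (w : List α) (c : α) : treeL (w ++ [c]) = insL c (treeL w) := by
  simp [treeL]

theorem treeL_append_congr {u v : List α} (h : treeL u = treeL v) (w : List α) :
    treeL (u ++ w) = treeL (v ++ w) := by
  simp only [treeL, List.foldl_append] at *
  rw [h]

/-- The number of nodes of a tree that are labelled `a`. -/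
def treeCount (a : α) : BinaryTree α → ℕ
  | .nil => 0
  | .node x l r => (if x = a then 1 else 0) + treeCount a l + treeCount a r

theorem treeCount_insL (a c : α) (T : BinaryTree α) :
    treeCount a (insL c T) = treeCount a T + if c = a then 1 else 0 := by
  induction T with
  | nil => simp [insL, treeCount]
  | node x l r ihl ihr =>
    by_cases h : c < x <;> simp only [insL, h, if_true, if_false, treeCount, ihl, ihr] <;> omega

theorem treeCount_treeL (a : α) (w : List α) : treeCount a (treeL w) = w.count a := by
  induction w using List.reverseRecOn with
  | nil => rfl
  | append_singleton w c ih =>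
    rw [treeL_append_singleton, treeCount_insL, ih, List.count_append]
    simp [List.count_cons]

/-- The label of the root of a tree. -/
def treeRoot : BinaryTree α → Option α
  | .nil => none
  | .node x _ _ => some x

theorem treeRoot_treeL (w : List α) : treeRoot (treeL w) = w.head? := by
  induction w using List.reverseRecOn with
  | nil => rfl
  | append_singleton w c ih =>
    rw [treeL_append_singleton, List.head?_append, ← ih]
    cases treeL w with
    | nil => rfl
    | node x l r => by_cases h : c < x <;> simp [insL, h, treeRoot]

/-- The number of occurrences of `a` before the first symbol in `(a, b]`. -/
def leadCount (a b : α) (w : List α) : ℕ :=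
  (w.takeWhile (fun c => ¬ (a < c ∧ c ≤ b))).count a

/-- On the path of the search for `b`, the number of nodes labelled `a` before the first label in
`(a, b]`, and whether there is such a label. -/
def treeLead (a b : α) : BinaryTree α → ℕ × Bool
  | .nil => (0, false)
  | .node x l r =>
    if x ≤ a then ((treeLead a b r).1 + if x = a then 1 else 0, (treeLead a b r).2)
    else if x ≤ b then (0, true) else treeLead a b l

/-- Labels outside `(a, b]` do not distinguish the symbols of `[a, b]`. Up to the first label in
`(a, b]` these symbols therefore all follow the search path of `b`, and later insertions do not
affect that part of the count. -/
theorem treeLead_insL {a b : α} (hab : a < b) (c : α) (T : BinaryTree α) :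
    treeLead a b (insL c T) = if (treeLead a b T).2 then treeLead a b T
      else ((treeLead a b T).1 + if c = a then 1 else 0, decide (a < c ∧ c ≤ b)) := by
  induction T with
  | nil => grind [insL, treeLead]
  | node x l r ihl ihr =>
    by_cases hc : c < x
    · simp only [insL, hc, if_true, treeLead, ihl]
      by_cases h1 : x ≤ a <;> by_cases h2 : x ≤ b <;> grind
    · simp only [insL, hc, if_false, treeLead, ihr]
      by_cases h1 : x ≤ a <;> by_cases h2 : x ≤ b <;> grind

theorem treeLead_treeL {a b : α} (hab : a < b) (w : List α) :
    treeLead a b (treeL w) = (leadCount a b w, w.any (fun c => a < c ∧ c ≤ b)) := by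
  induction w using List.reverseRecOn with
  | nil => rfl
  | append_singleton w c ih =>
    rw [treeL_append_singleton, treeLead_insL hab, ih]
    by_cases h : w.any (fun c => decide (a < c ∧ c ≤ b)) = true
    · have h' : ¬ ∀ c ∈ w, decide (¬ (a < c ∧ c ≤ b)) = true := by
        simp only [List.any_eq_true, decide_eq_true_eq] at h
        obtain ⟨c, hc, h⟩ := h
        exact fun h' => (of_decide_eq_true (h' c hc)) h
      have h2 : ¬ (w.takeWhile (fun c => decide (¬ (a < c ∧ c ≤ b)))).length = w.length := by
        intro hl
        have := (List.takeWhile_prefix (l := w) (fun c => decide (¬ (a < c ∧ c ≤ b)))).eq_of_length hl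
        exact h' (List.takeWhile_eq_self_iff.1 this)
      rw [leadCount, leadCount, List.takeWhile_append, if_neg h2, List.any_append, h]
      simp
    · have h' : ∀ c ∈ w, decide (¬ (a < c ∧ c ≤ b)) = true := fun c hc =>
        decide_eq_true fun hca => h (List.any_eq_true.2 ⟨c, hc, decide_eq_true hca⟩)
      have h3 : w.any (fun c => decide (a < c ∧ c ≤ b)) = false := Bool.eq_false_iff.2 h
      rw [leadCount, leadCount, List.takeWhile_append_of_pos h', List.takeWhile_eq_self_iff.2 h',
        List.any_append, h3]
      by_cases hc : a < c ∧ c ≤ b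
      · simp [hc, hc.1.ne']
      · by_cases hca : c = a
        · simp [hca]
        · rw [List.takeWhile_cons_of_pos (p := fun c => decide (¬ (a < c ∧ c ≤ b)))
            (decide_eq_true hc)]
          simp [hca]

theorem leadCount_append_cons {a b c : α} {p r : List α} (hp : ∀ x ∈ p, ¬ (a < x ∧ x ≤ b))
    (hc : a < c ∧ c ≤ b) : leadCount a b (p ++ c :: r) = p.count a := by
  rw [leadCount, List.takeWhile_append_of_pos fun x hx => decide_eq_true (hp x hx),
    List.takeWhile_cons_of_neg (by simpa using hc), List.append_nil]

theorem leadCount_eq_of_treeL_eq {a b : α} (hab : a < b) {u v : List α} (h : treeL u = treeL v) :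
    leadCount a b u = leadCount a b v := by
  have := treeLead_treeL hab u
  rw [h, treeLead_treeL hab v] at this
  exact (congrArg Prod.fst this).symm

end SearchTrees

/-! ### Substitutions of words over the ordered alphabet, and identities of `baxt_n` -/

section Sharp

variable {n : ℕ}

theorem mem_sharp {a : Fin n} {w : List (Fin n)} : a ∈ sharp w ↔ a.rev ∈ w := by
  simp only [sharp, List.mem_reverse, List.mem_map]
  constructor
  · rintro ⟨b, hb, rfl⟩
    rwa [Fin.rev_rev]
  · exact fun h => ⟨_, h, Fin.rev_rev a⟩

/-- Mirror image under `♯` of the statement for `treeR`; the strict and weak inequalities on the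
separator change places. -/
theorem treeL_append_eq_of_perm {u v s : List (Fin n)} (h : u.Perm v)
    (hs : ∀ a ∈ u, ∀ b ∈ u, a < b → ∃ x ∈ s, a < x ∧ x ≤ b) : treeL (s ++ u) = treeL (s ++ v) := by
  rw [treeL_eq_iff, sharp_append, sharp_append]
  refine treeR_append_eq_of_perm ?_ ?_
  · exact (List.reverse_perm _).trans ((h.map _).trans (List.reverse_perm _).symm)
  · intro a ha b hb hab
    obtain ⟨x, hx, h1, h2⟩ := hs _ (mem_sharp.1 hb) _ (mem_sharp.1 ha) (Fin.rev_lt_rev.2 hab)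
    exact ⟨x.rev, mem_sharp.2 (by rwa [Fin.rev_rev]), Fin.rev_le_rev.1 (by rwa [Fin.rev_rev]),
      Fin.rev_lt_rev.1 (by rwa [Fin.rev_rev])⟩

/-- The value of a word over `X ∪ X*` under a substitution of words over `{1 < ⋯ < n}`. -/
def sharpSubst (ψ : ℕ → List (Fin n)) (u : Word) : List (Fin n) :=
  u.flatMap (fun a => if a.2 then sharp (ψ a.1) else ψ a.1)

theorem sharpSubst_append (ψ : ℕ → List (Fin n)) (u v : Word) :
    sharpSubst ψ (u ++ v) = sharpSubst ψ u ++ sharpSubst ψ v := by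
  simp [sharpSubst]

theorem sharpSubst_cons (ψ : ℕ → List (Fin n)) (a : Letter) (v : Word) :
    sharpSubst ψ (a :: v) = (if a.2 then sharp (ψ a.1) else ψ a.1) ++ sharpSubst ψ v := by
  simp [sharpSubst]

theorem Baxt.eval_mk (ψ : ℕ → List (Fin n)) (u : Word) :
    Word.eval (fun i => Baxt.mk (ψ i)) u = Baxt.mk (sharpSubst ψ u) := by
  induction u with
  | nil => rfl
  | cons a u ih =>
    rw [eval_cons, ih, sharpSubst_cons, Baxt.mk_append]
    split <;> rfl

theorem Baxt.satisfiesWord_iff (u v : Word) : SatisfiesWord (Baxt n) u v ↔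
    u ≠ [] ∧ v ≠ [] ∧
      ∀ ψ : ℕ → List (Fin n), baxterP (sharpSubst ψ u) = baxterP (sharpSubst ψ v) := by
  refine and_congr_right fun _ => and_congr_right fun _ => ⟨fun h ψ => ?_, fun h φ => ?_⟩
  · rw [← Baxt.mk_eq_mk, ← Baxt.eval_mk, ← Baxt.eval_mk, h]
  · choose ψ hψ using fun i => (φ i).exists_mk
    obtain rfl : (fun i => Baxt.mk (ψ i)) = φ := funext hψ
    rw [Baxt.eval_mk, Baxt.eval_mk, Baxt.mk_eq_mk, h]

theorem SatisfiesWord.treeL_eq {u v : Word} (h : SatisfiesWord (Baxt n) u v)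
    (ψ : ℕ → List (Fin n)) : treeL (sharpSubst ψ u) = treeL (sharpSubst ψ v) :=
  congrArg Prod.fst (((Baxt.satisfiesWord_iff u v).1 h).2.2 ψ)

end Sharp

/-- The identities `p_k ≈ q_k` hold in `baxt_3` with Schützenberger's involution. -/
theorem satisfiesWord_pWord_qWord (k : ℕ) : SatisfiesWord (Baxt 3) (pWord k) (qWord k) := by
  rw [Baxt.satisfiesWord_iff]
  refine ⟨by simp [pWord], by simp [qWord], fun ψ => ?_⟩
  have hYα : ∀ c, c ∈ sharpSubst ψ (plainAsc k) → c.rev ∈ sharpSubst ψ (starAsc k) := by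
    intro c hc
    obtain ⟨a, ha, hc⟩ := List.mem_flatMap.1 hc
    obtain ⟨h1, h2⟩ := mem_plainAsc.1 ha
    refine List.mem_flatMap.2 ⟨a.inv, mem_starAsc.2 ⟨by simp [Letter.inv, h1], h2⟩, ?_⟩
    simpa [Letter.inv, h1, mem_sharp] using hc
  have hYβ : ∀ c, c ∈ sharpSubst ψ (plainAsc k) → c.rev ∈ sharpSubst ψ (starOddEven k) := by
    intro c hc
    obtain ⟨a, ha, hc⟩ := List.mem_flatMap.1 hc
    obtain ⟨h1, h2⟩ := mem_plainAsc.1 ha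
    refine List.mem_flatMap.2 ⟨a.inv, mem_starOddEven.2 ⟨by simp [Letter.inv, h1], h2⟩, ?_⟩
    simpa [Letter.inv, h1, mem_sharp] using hc
  have e1 : ∀ b, sharpSubst ψ [(0, b)] = if b then sharp (ψ 0) else ψ 0 := by simp [sharpSubst]
  have e2 : sharpSubst ψ [pl 0, st 0] = ψ 0 ++ sharp (ψ 0) := by simp [sharpSubst]
  have e3 : sharpSubst ψ [st 0, pl 0] = sharp (ψ 0) ++ ψ 0 := by simp [sharpSubst]
  simp only [pWord, qWord, sharpSubst_append, e1, e2, e3, if_true]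
  generalize ψ 0 = X at *
  generalize sharpSubst ψ (starAsc k) = A at *
  generalize sharpSubst ψ (starOddEven k) = B at *
  generalize sharpSubst ψ (plainAsc k) = Y at *
  by_cases hX : ∀ c ∈ X, c = 1
  -- The middle symbol `1 : Fin 3` is fixed by `♯`, so here the two words coincide.
  · have : sharp X = X := by
      rw [List.eq_replicate_of_mem hX, sharp, List.map_replicate, List.reverse_replicate]
      rfl
    rw [this]
    simp
  push Not at hX
  obtain ⟨c, hc, hc1⟩ := hX
  -- Since `♯` exchanges `0` and `2`, one occurrence of either in `X` puts both into `X X♯`.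
  have h02 : ((0 : Fin 3) ∈ X ∨ (0 : Fin 3) ∈ sharp X) ∧
      ((2 : Fin 3) ∈ X ∨ (2 : Fin 3) ∈ sharp X) := by
    simp only [mem_sharp]
    fin_cases c
    · exact ⟨.inl hc, .inr hc⟩
    · exact absurd rfl hc1
    · exact ⟨.inr hc, .inl hc⟩
  have hperm : (sharp X ++ Y ++ X).Perm (X ++ Y ++ sharp X) := by
    rw [List.perm_iff_count]
    intro a
    simp only [List.count_append]
    omega
  have h1 : ∀ Z : List (Fin 3), (∀ c ∈ Y, c.rev ∈ Z) → (1 : Fin 3) ∈ sharp X ++ Y ++ X →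
      (1 : Fin 3) ∈ X ∨ (1 : Fin 3) ∈ Z := by
    intro Z hZ h
    simp only [List.mem_append, mem_sharp] at h
    rcases h with (h | h) | h
    · exact .inl h
    · exact .inr (hZ _ h)
    · exact .inl h
  refine Prod.ext ?_ ?_
  · have hL : treeL (A ++ (X ++ sharp X) ++ (sharp X ++ Y ++ X)) =
        treeL (A ++ (X ++ sharp X) ++ (X ++ Y ++ sharp X)) := by
      -- The larger symbol `b` is itself the separator: `2` occurs in `X X♯`, while `1` occurs there
      -- or in `A`, which contains the reversed symbols of `Y`.
      refine treeL_append_eq_of_perm hperm fun a ha b hb hab => ?_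
      by_cases hb2 : b = 2
      · subst hb2
        exact ⟨2, by simp only [List.mem_append]; tauto, hab, le_rfl⟩
      · have hb1 : b = 1 := by omega
        subst hb1
        have := h1 A hYα hb
        exact ⟨1, by simp only [List.mem_append]; tauto, hab, le_rfl⟩
    simpa [baxterP] using treeL_append_congr hL (sharp X ++ X ++ B)
  · have hR : treeR ((sharp X ++ Y ++ X) ++ (sharp X ++ X ++ B)) =
        treeR ((X ++ Y ++ sharp X) ++ (sharp X ++ X ++ B)) := by
      -- Dually, the smaller symbol `a`, being `0` or `1`, is the separator, now found in `X♯ X B`.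
      refine treeR_append_eq_of_perm hperm fun a ha b hb hab => ?_
      by_cases ha0 : a = 0
      · subst ha0
        exact ⟨0, by simp only [List.mem_append]; tauto, le_rfl, hab⟩
      · have ha1 : a = 1 := by omega
        subst ha1
        have := h1 B hYβ ha
        exact ⟨1, by simp only [List.mem_append]; tauto, le_rfl, hab⟩
    simpa [baxterP] using treeR_append_congr (A ++ (X ++ sharp X)) _ _ _ rfl hR

/-! ### The word identities of `baxt_3` -/

theorem sharpSubst_restrict {n : ℕ} (ψ : ℕ → List (Fin n)) (p : ℕ → Bool)
    (hψ : ∀ i, p i = false → ψ i = []) (u : Word) :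
    sharpSubst ψ (u.filter (fun c => p c.1)) = sharpSubst ψ u := by
  induction u with
  | nil => rfl
  | cons a u ih =>
    rw [List.filter_cons]
    by_cases h : p a.1 = true
    · rw [if_pos h, sharpSubst_cons, sharpSubst_cons, ih]
    · rw [if_neg h, ih, sharpSubst_cons, hψ _ (by simpa using h)]
      simp [sharp]

theorem sharp_singleton {n : ℕ} (a : Fin n) : sharp [a] = [a.rev] := rfl

/-- The substitution `xₘ ↦ a`, `xₙ ↦ b`, and `xᵢ ↦ 1` for all other `i`. -/
def twoSubst (m n : ℕ) (a b : Fin 3) (i : ℕ) : List (Fin 3) :=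
  if i = m then [a] else if i = n then [b] else []

theorem count_zero_sharpSubst {ψ : ℕ → List (Fin 3)} {w : Word} {c : Letter}
    (hψ : ψ c.1 = [if c.2 then 2 else 0]) (hw : ∀ d ∈ w, d.1 ≠ c.1 → 0 ∉ ψ d.1 ∧ 2 ∉ ψ d.1) :
    (sharpSubst ψ w).count 0 = w.count c := by
  induction w with
  | nil => rfl
  | cons d w ih =>
    rw [sharpSubst_cons, List.count_append, ih (fun e he => hw e (by simp [he])), List.count_cons]
    by_cases hd : d.1 = c.1
    · rw [hd, hψ, sharp_singleton]
      rcases c with ⟨m, _ | _⟩ <;> rcases d with ⟨m', _ | _⟩ <;> simp at hd <;>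
        simp [hd, add_comm]
    · obtain ⟨h0, h2⟩ := hw d (by simp) hd
      have hdc : d ≠ c := fun h => hd (by rw [h])
      have : (if d.2 then sharp (ψ d.1) else ψ d.1).count 0 = 0 := by
        rw [List.count_eq_zero]
        split
        · rw [mem_sharp]; exact h2
        · exact h0
      simp [this, hdc]

section Baxt3

variable {u v : Word}

theorem balancedIdentity_of_baxt (h : SatisfiesWord (Baxt 3) u v) : BalancedIdentity u v := by
  intro c
  have h1 := h.treeL_eq (fun i => if i = c.1 then [if c.2 then 2 else 0] else [])
  have h2 := congrArg (treeCount 0) h1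
  rwa [treeCount_treeL, treeCount_treeL, count_zero_sharpSubst (c := c) (by simp) (by simp +contextual),
    count_zero_sharpSubst (c := c) (by simp) (by simp +contextual)] at h2

theorem head?_sharpSubst_twoSubst (w : Word) (m n : ℕ) :
    (sharpSubst (twoSubst m n 0 1) w).head? =
      (w.filter (fun c => c.1 = m ∨ c.1 = n)).head?.map
        (fun c => if c.1 = m then if c.2 then 2 else 0 else 1) := by
  induction w with
  | nil => rfl
  | cons a w ih =>
    rcases a with ⟨i, _ | _⟩ <;> by_cases hm : i = m <;> by_cases hn : i = n <;>
      simp_all [sharpSubst_cons, twoSubst, sharp]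

/-- Send the index of the leading letter `a` to `0` and the other to `1`. A root `0` or `2`
identifies `a` together with its star, whereas the other variable and its star both become `1`;
hence the symmetric case split on which index leads. -/
theorem head?_filter_of_head?_eq_some (h : SatisfiesWord (Baxt 3) u v) {m n : ℕ} {a : Letter}
    (ha : (u.filter (fun c => c.1 = m ∨ c.1 = n)).head? = some a) :
    (v.filter (fun c => c.1 = m ∨ c.1 = n)).head? = some a := by
  have main : ∀ n', (u.filter (fun c => c.1 = a.1 ∨ c.1 = n')).head? = some a →
      (v.filter (fun c => c.1 = a.1 ∨ c.1 = n')).head? = some a := by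
    intro n' ha'
    have h2 := congrArg treeRoot (h.treeL_eq (twoSubst a.1 n' 0 1))
    rw [treeRoot_treeL, treeRoot_treeL, head?_sharpSubst_twoSubst, head?_sharpSubst_twoSubst,
      ha', eq_comm] at h2
    simp only [Option.map_some, Option.map_eq_some_iff] at h2
    obtain ⟨b, hb, hba⟩ := h2
    rw [hb]
    rcases a with ⟨i, _ | _⟩ <;> rcases b with ⟨j, _ | _⟩ <;> by_cases hij : j = i <;>
      simp_all
  have hmem : a ∈ u.filter (fun c => c.1 = m ∨ c.1 = n) := List.mem_of_head? ha
  simp only [List.mem_filter, decide_eq_true_eq] at hmem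
  rcases hmem.2 with rfl | rfl
  · exact main n ha
  · simp only [or_comm (a := _ = m)] at ha ⊢
    exact main m ha

theorem head?_filter_eq (h : SatisfiesWord (Baxt 3) u v) (m n : ℕ) :
    (u.filter (fun c => c.1 = m ∨ c.1 = n)).head? =
      (v.filter (fun c => c.1 = m ∨ c.1 = n)).head? :=
  Option.ext fun _ => ⟨head?_filter_of_head?_eq_some h, head?_filter_of_head?_eq_some h.symm⟩

/-- A word in which each index occurs at most once is determined by its letters and by which of any
two comes first. -/
theorem eq_of_head?_filter_eq {p q : Word} (hp : (p.map Prod.fst).Nodup)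
    (hq : (q.map Prod.fst).Nodup)
    (h : ∀ m n : ℕ, (p.filter (fun c => c.1 = m ∨ c.1 = n)).head? =
      (q.filter (fun c => c.1 = m ∨ c.1 = n)).head?) : p = q := by
  induction p generalizing q with
  | nil =>
    rcases q with _ | ⟨b, q⟩
    · rfl
    · simpa using h b.1 b.1
  | cons a p ih =>
    rcases q with _ | ⟨b, q⟩
    · simpa using h a.1 a.1
    · obtain rfl : a = b := by simpa using h a.1 b.1
      rw [List.map_cons, List.nodup_cons] at hp hq
      have e : ∀ {w : Word}, a.1 ∉ w.map Prod.fst → ∀ n,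
          w.filter (fun c => c.1 = a.1 ∨ c.1 = n) = w.filter (fun c => c.1 = n) :=
        fun {w} hw n => List.filter_congr fun c hc => by
          have : c.1 ≠ a.1 := fun h => hw (List.mem_map.2 ⟨c, hc, h⟩)
          simp [this]
      have main : ∀ n, (p.filter (fun c => c.1 = n)).head? = (q.filter (fun c => c.1 = n)).head? := by
        intro n
        by_cases hn : a.1 = n
        · subst hn
          have z : ∀ {w : Word}, a.1 ∉ w.map Prod.fst → w.filter (fun c => c.1 = a.1) = [] :=
            fun {w} hw => filter_eq_nil_of_forall fun c hc => by
              have : c.1 ≠ a.1 := fun h => hw (List.mem_map.2 ⟨c, hc, h⟩)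
              simp [this]
          rw [z hp.1, z hq.1]
        · simpa [hn] using h n n
      rw [ih hp.2 hq.2]
      intro m n
      by_cases hm : a.1 = m
      · subst hm
        rw [e hp.1, e hq.1, main]
      by_cases hn : a.1 = n
      · subst hn
        simp only [or_comm (a := _ = m)]
        rw [e hp.1, e hq.1, main]
      · simpa [hm, hn] using h m n

theorem initialPart_eq_of_baxt (h : SatisfiesWord (Baxt 3) u v) :
    initialPart u = initialPart v := by
  refine eq_of_head?_filter_eq (nodup_initialPart u) (nodup_initialPart v) fun m n => ?_
  rw [← initialPart_filter (fun i => decide (i = m ∨ i = n)),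
    ← initialPart_filter (fun i => decide (i = m ∨ i = n)), head?_initialPart, head?_initialPart]
  exact head?_filter_eq h m n

theorem preservesParts_baxt : PreservesParts (Baxt 3) := by
  intro u v h
  refine ⟨initialPart_eq_of_baxt h, ?_, balancedIdentity_of_baxt h⟩
  have := initialPart_eq_of_baxt h.winv
  rw [initialPart_winv, initialPart_winv] at this
  rw [← winv_winv (finalPart u), this, winv_winv]

theorem leadCount_eq_of_baxt (h : SatisfiesWord (Baxt 3) u v) {a b : Fin 3} (hab : a < b)
    (ψ : ℕ → List (Fin 3)) :
    leadCount a b (sharpSubst ψ u) = leadCount a b (sharpSubst ψ v) :=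
  leadCount_eq_of_treeL_eq hab (h.treeL_eq ψ)

theorem preservesPrefixes_baxt : PreservesPrefixes (Baxt 3) := by
  intro u v h x y hxy a r ha hu
  rw [List.append_assoc, List.singleton_append] at hu
  have hyu : y ∈ u := (mem_restrict.1 (by rw [hu]; simp : y ∈ restrict u x y)).1
  have hyv : y ∈ v := by
    rw [← List.count_pos_iff, ← balancedIdentity_of_baxt h y]
    exact List.count_pos_iff.2 hyu
  obtain ⟨a', y', r', hv, ha', hy'⟩ := exists_first_split (fun c : Letter => c.1 = y.1)
    (restrict v x y) ⟨y, mem_restrict.2 ⟨hyv, .inr rfl⟩, rfl⟩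
  have hay : ∀ c ∈ a, c.1 ≠ y.1 := by
    intro c hc
    rcases (ha c).1 hc with rfl | rfl
    · exact hxy
    · exact hxy
  have hhead := head?_filter_eq h y.1 y.1
  simp only [or_self] at hhead
  rw [← filter_restrict_right u x y, ← filter_restrict_right v x y, hu, hv, List.filter_append,
    List.filter_append, filter_eq_nil_of_forall (l := a) (by simpa using hay),
    filter_eq_nil_of_forall (l := a') (by simpa using ha')] at hhead
  obtain rfl : y = y' := by simpa [hy'] using hhead
  refine ⟨a', r', ?_, by simpa using hv⟩
  have ha'x : ∀ c ∈ a', c.1 = x.1 := by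
    intro c hc
    have := (mem_restrict.1 (by rw [hv]; simp [hc] : c ∈ restrict v x y)).2
    exact this.resolve_right (ha' c hc)
  have hax : ∀ c ∈ a, c.1 = x.1 := by
    intro c hc
    rcases (ha c).1 hc with rfl | rfl <;> rfl
  rw [List.perm_iff_count]
  intro c
  by_cases hc : c.1 = x.1
  -- Now `c` becomes `0`, `c*` becomes `2`, and both `y` and `y*` become `1`, so `leadCount 0 1`
  -- counts the occurrences of `c` before the first `y`.
  · set ψ := twoSubst c.1 y.1 (if c.2 then 2 else 0) 1 with hψ
    have hcy : y.1 ≠ c.1 := fun h => hxy (hc.symm.trans h.symm)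
    have hψc : ψ c.1 = [if c.2 then 2 else 0] := by simp [hψ, twoSubst]
    have hψy : ψ y.1 = [1] := by simp [hψ, twoSubst, hcy]
    have key : ∀ {w p r : Word}, restrict w x y = p ++ y :: r → (∀ d ∈ p, d.1 = x.1) →
        leadCount 0 1 (sharpSubst ψ w) = p.count c := by
      intro w p r hw hp
      have hres : sharpSubst ψ w = sharpSubst ψ (restrict w x y) :=
        (sharpSubst_restrict ψ (fun i => decide (i = x.1 ∨ i = y.1)) (fun i hi => by
          simp only [decide_eq_false_iff_not, not_or] at hi
          simp [hψ, twoSubst, hc, hi]) w).symm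
      have hy1 : (if y.2 then sharp (ψ y.1) else ψ y.1) = [1] := by
        rw [hψy]; cases y.2 <;> rfl
      rw [hres, hw, sharpSubst_append, sharpSubst_cons, hy1, List.singleton_append,
        leadCount_append_cons ?_ ⟨by decide, le_rfl⟩]
      · exact count_zero_sharpSubst hψc fun d hd hdc => absurd ((hp d hd).trans hc.symm) hdc
      · intro z hz
        obtain ⟨d, hd, hz⟩ := List.mem_flatMap.1 hz
        rw [(hp d hd).trans hc.symm, hψc, sharp_singleton] at hz
        rintro ⟨h0, h1⟩
        rcases c with ⟨_, _ | _⟩ <;> rcases d with ⟨_, _ | _⟩ <;> simp at hz <;> subst hz <;>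
          revert h0 h1 <;> decide
    rw [← key hu hax, ← key hv ha'x]
    exact (leadCount_eq_of_baxt h (by decide) ψ).symm
  · rw [List.count_eq_zero.2 fun hm => hc (hax c hm), List.count_eq_zero.2 fun hm => hc (ha'x c hm)]

end Baxt3

/-- If the left side of an identity of `baxt_3` starts with `y* x x*` and the right side starts
with `y*` and two occurrences of `x` or `x*`, then the right side starts with `y* x x*`. -/
theorem eq_of_prefix_of_baxt {x y b c : Letter} (hxy : x.1 ≠ y.1) {u v : Word}
    (h : SatisfiesWord (Baxt 3) (y.inv :: x :: x.inv :: u) (y.inv :: b :: c :: v))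
    (hb : b.1 = x.1) (hc : c.1 = x.1) : b = x ∧ c = x.inv := by
  have hyx : y.1 ≠ x.1 := hxy.symm
  obtain rfl : x = b := by
    simpa [Letter.inv, hyx, hb] using head?_filter_eq h x.1 x.1
  refine ⟨rfl, ?_⟩
  rcases Letter.eq_or_eq_inv hc with rfl | rfl
  · exfalso
    -- With `y*` and `x` sent to `0` and `x*` to `2`, the left side has two zeros before its first
    -- `2`, while a start `y* x x` gives at least three before any nonzero symbol.
    have h2 := leadCount_eq_of_baxt h (show (0 : Fin 3) < 2 by decide)
      (twoSubst c.1 y.1 (if c.2 then 2 else 0) (if y.2 then 0 else 2))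
    rcases c with ⟨m, _ | _⟩ <;> rcases y with ⟨n, _ | _⟩ <;>
      simp [sharpSubst_cons, twoSubst, Letter.inv, sharp, hyx, leadCount] at h2
  · rfl

theorem count_one_sharpSubst {m n : ℕ} (hmn : m ≠ n) {w : Word}
    (hw : ∀ c ∈ w, c.1 = m ∨ c.1 = n) :
    (sharpSubst (twoSubst m n 1 2) w).count 1 + w.count (pl n) + w.count (st n) = w.length := by
  induction w with
  | nil => rfl
  | cons c w ih =>
    have := ih fun d hd => hw d (by simp [hd])
    have hc := hw c (by simp)
    rw [sharpSubst_cons, List.count_append, List.count_cons, List.count_cons, List.length_cons]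
    rcases c with ⟨i, _ | _⟩ <;> rcases hc with hi | hi <;> simp only at hi <;>
      simp [twoSubst, hi, sharp, hmn, hmn.symm] <;> omega

/-- Balance, both ends and the number of `x`-letters before `y` reduce `w` to `y* b c d y e f g y*`.
The two-letter prefix argument, applied also to the starred identity, fixes `b, c, f, g`, and
balance leaves two choices for `d, e`. -/
theorem rigidBlocks_baxt : RigidBlocks (Baxt 3) := by
  intro x y w hxy h hne
  have hyx := hxy.symm
  have hbal := balancedIdentity_of_baxt h
  have hlet : ∀ c ∈ w, c.1 = x ∨ c.1 = y := by
    intro c hc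
    rw [← List.count_pos_iff, ← hbal c, List.count_pos_iff] at hc
    simp only [List.mem_cons, List.not_mem_nil, or_false] at hc
    rcases hc with rfl | rfl | rfl | rfl | rfl | rfl | rfl | rfl | rfl <;> simp
  have cx := hbal (pl x)
  have cy := hbal (pl y)
  have cy' := hbal (st y)
  simp [hxy, hyx] at cx cy cy'
  obtain ⟨p, r, rfl⟩ := List.append_of_mem (List.count_pos_iff.1 (by omega : 0 < w.count (pl y)))
  have ex : (pl y == pl x) = false := by simp [hyx]
  have ey : (pl y == st y) = false := by simp
  simp only [List.count_append, List.count_cons, beq_self_eq_true, if_true, ex, ey,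
    Bool.false_eq_true, if_false, add_zero] at cx cy cy'
  have hpy : p.count (pl y) = 0 := by omega
  have hry : r.count (pl y) = 0 := by omega
  have hlp := count_one_sharpSubst hxy (w := p) fun c hc => hlet c (by simp [hc])
  -- Here `x` and `x*` become `1`, `y` becomes `2` and `y*` becomes `0`, which is not counted: three
  -- letters `x` or `x*` precede `y`.
  have hlead := leadCount_eq_of_baxt h (show (1 : Fin 3) < 2 by decide) (twoSubst x y 1 2)
  have hs : sharpSubst (twoSubst x y 1 2) (pl y :: r) = 2 :: sharpSubst (twoSubst x y 1 2) r := by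
    simp [sharpSubst_cons, twoSubst, hyx]
  rw [sharpSubst_append, hs, leadCount_append_cons (p := sharpSubst _ p) ?_ ⟨by decide, le_rfl⟩]
    at hlead
  swap
  · intro z hz
    obtain ⟨d, hd, hz⟩ := List.mem_flatMap.1 hz
    rcases d with ⟨i, _ | _⟩ <;> rcases hlet _ (List.mem_append_left _ hd) with hi | hi <;>
      simp only at hi <;> subst hi
    · simp [twoSubst] at hz; subst hz; decide
    · exact absurd hd (List.count_eq_zero.1 hpy)
    · simp [twoSubst, sharp] at hz; subst hz; decide
    · simp [twoSubst, sharp, hyx] at hz; subst hz; decide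
  simp [sharpSubst_cons, twoSubst, sharp, hyx, leadCount] at hlead
  have hlen := (List.perm_iff_count.2 hbal).length_eq
  have hself : ∀ {l : Word}, (∀ c ∈ l, c.1 = x ∨ c.1 = y) →
      l.filter (fun c => c.1 = x ∨ c.1 = y) = l := fun {l} hl =>
    List.filter_eq_self.2 fun c hc => decide_eq_true (hl c hc)
  have hhead := head?_filter_eq h x y
  rw [hself hlet] at hhead
  obtain ⟨p, rfl⟩ : ∃ p', p = st y :: p' := by
    rcases p with _ | ⟨c, p⟩
    · simp at hhead
    · exact ⟨p, by simp at hhead; rw [hhead]⟩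
  have hlast := head?_filter_eq h.winv x y
  rw [hself (l := winv (_ ++ _)) fun c hc =>
    show c.inv.1 = x ∨ c.inv.1 = y from hlet _ (mem_winv.1 hc)] at hlast
  obtain ⟨r, rfl⟩ : ∃ r', r = r' ++ [st y] := by
    rcases List.eq_nil_or_concat r with rfl | ⟨r, c, rfl⟩
    · simp [winv, Letter.inv] at hlast
    · refine ⟨r, ?_⟩
      rcases c with ⟨i, _ | _⟩ <;> simp [winv, Letter.inv] at hlast
      simp [hlast]
  simp only [List.count_append, List.count_cons, List.length_append, List.length_cons,
    List.length_nil, List.count_nil, beq_self_eq_true, if_true] at *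
  have hpl : p.length = 3 := by omega
  have hrl : r.length = 3 := by omega
  have hpr : ∀ c, c ∈ p ∨ c ∈ r → c.1 = x := by
    intro c hc
    refine (hlet c (by simp only [List.mem_append, List.mem_cons]; tauto)).resolve_right fun hy => ?_
    have z : ∀ {d : Letter}, p.count d = 0 → r.count d = 0 → c ≠ d := by
      rintro d h1 h2 rfl
      exact hc.elim (List.count_eq_zero.1 h1) (List.count_eq_zero.1 h2)
    rcases c with ⟨i, _ | _⟩
    · exact z (d := pl y) (by omega) (by omega) (by rw [← hy])
    · exact z (d := st y) (by omega) (by omega) (by rw [← hy])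
  obtain ⟨b, c, d, rfl⟩ := List.length_eq_three.1 hpl
  obtain ⟨e, f, g, rfl⟩ := List.length_eq_three.1 hrl
  obtain ⟨rfl, rfl⟩ := eq_of_prefix_of_baxt (x := pl x) (y := pl y) hxy h
    (hpr b (by simp)) (hpr c (by simp))
  obtain ⟨hg, hf⟩ := eq_of_prefix_of_baxt (x := st x) (y := st y) (b := g.inv) (c := f.inv) hxy h.winv
    (hpr g (by simp)) (hpr f (by simp))
  obtain rfl : g = pl x := by rw [← Letter.inv_inv g, hg]; rfl
  obtain rfl : f = st x := by rw [← Letter.inv_inv f, hf]; rfl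
  have hd := hpr d (by simp)
  have he := hpr e (by simp)
  obtain ⟨i, _ | _⟩ := d <;> obtain ⟨j, _ | _⟩ := e <;> simp only at hd he <;> subst hd he
  · simp [Letter.inv] at cx
  · rfl
  · exact absurd rfl hne
  · simp [Letter.inv] at cx

end BaxterInv

open BaxterInv
theorem mainTheorem1 :
    (∀ (M : Type*) [Monoid M] [StarMul M],
      (∀ k : ℕ, 2 ≤ k → SatisfiesWord M (pWord k) (qWord k)) →
      (∀ u v : Word, SatisfiesWord M u v →
        initialPart u = initialPart v ∧ finalPart u = finalPart v ∧ BalancedIdentity u v) →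
      (∀ (x y : ℕ) (w : Word), x ≠ y →
        SatisfiesWord M [st y, pl x, st x, st x, pl y, pl x, st x, pl x, st y] w →
        w ≠ [st y, pl x, st x, st x, pl y, pl x, st x, pl x, st y] →
        w = [st y, pl x, st x, pl x, pl y, st x, st x, pl x, st y]) →
      (∀ u v : Word, SatisfiesWord M u v → ∀ x y : Letter, x.1 ≠ y.1 → ∀ a r : Word,
        (∀ c : Letter, c ∈ a ↔ c = x ∨ c = x.inv) →
        (restrict u x y = a ++ [y] ++ r →
          ∃ a' r' : Word, a'.Perm a ∧ restrict v x y = a' ++ [y] ++ r') ∧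
        (restrict u x y = r ++ [y] ++ a →
          ∃ a' r' : Word, a'.Perm a ∧ restrict v x y = r' ++ [y] ++ a')) →
      ¬ FinitelyBased M) ∧
    ¬ FinitelyBased (Baxt 3) := by
  refine ⟨fun M _ _ hI hII hIII hIV => ?_, ?_⟩
  · exact not_finitelyBased_of_conditions hI hII hIII
      fun u v h x y hxy a r ha => (hIV u v h x y hxy a r ha).1
  · exact not_finitelyBased_of_conditions (fun k _ => satisfiesWord_pWord_qWord k)
      preservesParts_baxt rigidBlocks_baxt preservesPrefixes_baxt
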